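/- Let $k$ be a commutative domain and let $A$ be a (unital, associative, not necessarily commutative) $k$-algebra that is a finitely generated domain containing $\mathbb{Z}$ and satisfies a polynomial identity, i.e. some polynomial in noncommuting variables over $k$, whose coefficients do not all become zero in $A$, vanishes under every substitution of elements of $A$. Suppose that $A$ has finite Gelfand–Kirillov dimension $$\operatorname{GKdim}A=\sup_V\ \limsup_{n\to\infty}\ \log_n \dim_{\operatorname{Frac}(k)}\bigl(V^n\otimes_k\operatorname{Frac}(k)\bigr)<\infty ,$$ where $V$ runs over the finitely generated $k$-submodules of $A$. Suppose that $A$ is not birationally affine-ruled, i.e. there is no division $k$-algebra $D$ such that the division ring of fractions $Q(A)$ is isomorphic as a $k$-algebra to $D(x)$, the division ring of fractions of the polynomial ring $D[x]$ in a central variable $x$. Then: (1) $A$ is LND-rigid: every locally nilpotent $k$-derivation of $A$ is zero; equivalently, the Makar-Limanov invariant $\operatorname{ML}(A)=\bigcap_{\delta}\ker\delta$, the intersection over all locally nilpotent $k$-derivations $\delta$ of $A$, equals $A$; (2) $A$ is cancellative: for every $k$-algebra $B$, if $A[t]\cong B[t]$ as $k$-algebras, then $A\cong B$ as $k$-algebras.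 -/

import Mathlib

universe v

/-- A locally nilpotent `k`-derivation of a (not necessarily commutative) `k`-algebra `A`. -/
structure IsLND (k : Type*) {A : Type*} [CommRing k] [Ring A] [Algebra k A]
    (δ : A →ₗ[k] A) : Prop where
  leibniz : ∀ a b : A, δ (a * b) = δ a * b + a * δ b
  locallyNilpotent : ∀ a : A, ∃ n : ℕ, (δ ^ n) a = 0

/-- The Makar-Limanov invariant: the intersection of the kernels of all locally nilpotent
`k`-derivations. -/
def makarLimanov (k A : Type*) [CommRing k] [Ring A] [Algebra k A] : Submodule k A :=
  ⨅ (δ : A →ₗ[k] A) (_ : IsLND k δ), LinearMap.ker δ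

/-- `A` is LND-rigid if its Makar-Limanov invariant is all of `A`. -/
def IsLNDRigid (k A : Type*) [CommRing k] [Ring A] [Algebra k A] : Prop :=
  makarLimanov k A = ⊤

/-- `A` is cancellative if `A[t] ≅ B[t]` implies `A ≅ B`, for every `k`-algebra `B`. Such a `B`
embeds in `A[t]`, so it is no restriction to take `B` in the universe of `A`. -/
def IsCancellative (k : Type*) (A : Type v) [CommRing k] [Ring A] [Algebra k A] : Prop :=
  ∀ (B : Type v) [Ring B] [Algebra k B],
    Nonempty (Polynomial A ≃ₐ[k] Polynomial B) → Nonempty (A ≃ₐ[k] B)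

/-- `A` satisfies a polynomial identity: some `f` in the free algebra `k⟨x₀, x₁, …⟩` vanishes under
all substitutions from `A`, while not all coefficients of `f` become zero in `A`
(if `k` embeds in `A`, this just says `f ≠ 0`). -/
def IsPI (k A : Type*) [CommRing k] [Ring A] [Algebra k A] : Prop :=
  ∃ f : FreeAlgebra k ℕ,
    (∃ w : FreeMonoid ℕ,
      algebraMap k A ((FreeAlgebra.equivMonoidAlgebraFreeMonoid f).coeff w) ≠ 0) ∧
    ∀ a : ℕ → A, FreeAlgebra.lift k a f = 0

/-- The rank of a module over a commutative domain `k`: the dimension of `M ⊗ Frac(k)`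
over `Frac(k)`. -/
noncomputable def domainRank (k M : Type*) [CommRing k] [IsDomain k] [AddCommGroup M]
    [Module k M] : ℕ :=
  Module.finrank (FractionRing k) (TensorProduct k (FractionRing k) M)

/-- The Gelfand-Kirillov dimension `sup_V limsup_n log_n (rank_k V ^ n)`, where `V` runs over the
finitely generated `k`-submodules of `A` (with `log 0 = -∞`). -/
noncomputable def gkDim (k A : Type*) [CommRing k] [IsDomain k] [Ring A] [Algebra k A] : EReal :=
  ⨆ (V : Submodule k A) (_ : V.FG),
    Filter.limsup
      (fun n : ℕ =>
        ENNReal.log (domainRank k ↥(V ^ n) : ENNReal) / ENNReal.log (n : ENNReal))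
      Filter.atTop

/-- `ι : A → Q` exhibits the division ring `Q` as the (two-sided) division ring of fractions of
the Ore domain `A`. -/
structure IsFractionDivisionRing {k A Q : Type*} [CommRing k] [Ring A] [Algebra k A]
    [DivisionRing Q] [Algebra k Q] (ι : A →ₐ[k] Q) : Prop where
  injective : Function.Injective ι
  left_fraction : ∀ q : Q, ∃ s a : A, s ≠ 0 ∧ q = (ι s)⁻¹ * ι a
  right_fraction : ∀ q : Q, ∃ a s : A, s ≠ 0 ∧ q = ι a * (ι s)⁻¹

/-- `A` is birationally affine-ruled: `Q(A) = D(x)` for some division `k`-algebra `D`, that is,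
one division `k`-algebra `Q` is the division ring of fractions both of `A` and of `D[x]`
(`x` a central variable). Such `Q` and `D` are no larger than `A`, so the universe of `A` suffices
for both. -/
def IsBirationallyAffineRuled (k : Type*) (A : Type v) [CommRing k] [Ring A] [Algebra k A] :
    Prop :=
  ∃ (Q : Type v) (_ : DivisionRing Q) (_ : Algebra k Q)
    (D : Type v) (_ : DivisionRing D) (_ : Algebra k D)
    (ι : A →ₐ[k] Q) (j : Polynomial D →ₐ[k] Q),
    IsFractionDivisionRing ι ∧ IsFractionDivisionRing j

/-! Rigidity holds because a nonzero locally nilpotent derivation δ makes A birationally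
affine-ruled. A multilinear consequence of the polynomial identity makes A an Ore domain and
persists in Q = Q(A), so Q is finite-dimensional over its center C by Kaplansky's theorem
(`IsMultilinearIdentity.finiteDimensional`). Extend δ to a derivation d of Q. The trace Q → C
commutes with d, and d moves the trace of some element of A, since otherwise δ would be nilpotent,
hence zero in characteristic zero. That trace is killed by a power of d, so one of its derivatives y
has d y ≠ 0 = d² y, and x = y / d y is a central slice: d x = 1
(`IsFractionDivisionRing.exists_central_slice`). With D = ker d, integration in x puts A inside
D[x], whence Q = D(x).

For cancellation, rigidity of A is carried to A[X]: every locally nilpotent derivation of A[X] kills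
A (`IsLND.apply_C_eq_zero`). Its top homogeneous component is again locally nilpotent and kills X,
so it comes from a locally nilpotent derivation of A, which is zero, and the degree drops. For φ :
A[X] ≅ B[X], pulling back d/dX then shows that φ maps A into B, and a comparison of degrees shows
that it maps onto B. -/

/-! ### Multilinearization of a polynomial identity -/

open Finset in
theorem sum_ite_subset_neg_one_pow {α R : Type*} [Fintype α] [DecidableEq α] [CommRing R]
    (T : Finset α) :
    ∑ S : Finset α, (if T ⊆ S then (-1 : R) ^ #S else 0) =
      if T = univ then (-1) ^ Fintype.card α else 0 := by
  -- Expand ∏ (-1 + [i ∉ T]), with `S` the set of factors contributing -1; the other factors give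
  -- the indicator of T ⊆ S.
  have h := Finset.prod_add (fun _ : α => (-1 : R)) (fun i => if i ∉ T then 1 else 0) univ
  have h1 : ∏ i : α, ((-1 : R) + if i ∉ T then 1 else 0) =
      if T = univ then (-1) ^ Fintype.card α else 0 := by
    split_ifs with hT
    · simp [hT]
    · obtain ⟨i, hi⟩ : ∃ i, i ∉ T := by
        by_contra! hc
        exact hT (eq_univ_iff_forall.2 hc)
      exact Finset.prod_eq_zero (mem_univ i) (by simp [hi])
  rw [← h1, h, powerset_univ]
  refine Finset.sum_congr rfl fun S _ => ?_
  rw [Finset.prod_const, Finset.prod_ite_zero]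
  have : (∀ i ∈ univ \ S, i ∉ T) ↔ T ⊆ S := by
    simp only [mem_sdiff, mem_univ, true_and, subset_iff]
    exact ⟨fun H i hi => by_contra fun hc => H i hc hi, fun H i hi hT => hi (H hT)⟩
  simp only [this, Finset.prod_const_one, mul_ite, mul_one, mul_zero]

open Finset in
/-- Inclusion-exclusion extracts the multilinear part of a word of length at most `d`. -/
theorem sum_neg_one_pow_mul_prod_map {A : Type*} [Ring A] {d : ℕ} (w : Fin d → ℕ) (z : Fin d → A)
    (u : List ℕ) (hu : u.length ≤ d) :
    ∑ S : Finset (Fin d), (-1) ^ #S * (u.map fun i => ∑ j ∈ S with w j = i, z j).prod =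
      (-1) ^ d * ∑ σ : Equiv.Perm (Fin d),
        if u = List.ofFn (w ∘ σ) then (List.ofFn (z ∘ σ)).prod else 0 := by
  obtain ⟨l, m, rfl⟩ : ∃ (l : ℕ) (m : Fin l → ℕ), u = List.ofFn m := ⟨_, _, (List.ofFn_get u).symm⟩
  rw [List.length_ofFn] at hu
  have h1 (S : Finset (Fin d)) :
      ((List.ofFn m).map fun i => ∑ j ∈ S with w j = i, z j).prod =
        ∑ r : Fin l → Fin d, if univ.image r ⊆ S then
          (if w ∘ r = m then (List.ofFn (z ∘ r)).prod else 0) else 0 := by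
    have := (MultilinearMap.mkPiAlgebraFin ℤ l A).map_sum_finset (fun _ j => z j)
      (fun t => S.filter fun j => w j = m t)
    simp only [MultilinearMap.mkPiAlgebraFin_apply] at this
    rw [List.map_ofFn]
    refine this.trans ?_
    rw [← Finset.sum_filter, ← Finset.sum_filter, Finset.filter_filter]
    refine Finset.sum_congr ?_ fun _ _ => rfl
    ext r
    simp only [Fintype.mem_piFinset, mem_filter, mem_univ, true_and, image_subset_iff, forall_true_left,
      funext_iff, Function.comp, forall_and]
  simp_rw [h1, Finset.mul_sum]
  rw [Finset.sum_comm]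
  -- The signed sum over all `S` containing the image of `r` cancels unless `r` is surjective. As l
  -- ≤ d, this leaves only permutations, with l = d.
  have h2 (r : Fin l → Fin d) :
      ∑ S : Finset (Fin d), (-1) ^ #S * (if univ.image r ⊆ S then
          (if w ∘ r = m then (List.ofFn (z ∘ r)).prod else 0) else 0) =
        if univ.image r = univ then
          (-1) ^ d * (if w ∘ r = m then (List.ofFn (z ∘ r)).prod else 0) else 0 := by
    have h := congrArg (Int.cast : ℤ → A) (sum_ite_subset_neg_one_pow (R := ℤ) (univ.image r))
    simp only [Fintype.card_fin] at h
    push_cast at h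
    rw [← ite_zero_mul, ← h, Finset.sum_mul]
    refine Finset.sum_congr rfl fun S _ => ?_
    split_ifs <;> simp
  simp_rw [h2]
  have h3 (r : Fin l → Fin d) : univ.image r = univ ↔ Function.Surjective r := by
    simp [Finset.eq_univ_iff_forall, Function.Surjective]
  rcases hu.lt_or_eq with hu | rfl
  · rw [Finset.sum_eq_zero, Finset.sum_eq_zero]
    · intro σ _
      rw [if_neg, mul_zero]
      intro h
      simpa [hu.ne] using congrArg List.length h
    · intro r _
      rw [if_neg]
      intro h
      have := Fintype.card_le_of_surjective r ((h3 r).1 h)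
      simp at this
      omega
  · symm
    refine Fintype.sum_of_injective (fun σ : Equiv.Perm (Fin l) => (σ : Fin l → Fin l))
      DFunLike.coe_injective _ _ ?_ ?_
    · intro r hr
      rw [if_neg]
      intro h
      exact hr ⟨Equiv.ofBijective r (Finite.surjective_iff_bijective.1 ((h3 r).1 h)), rfl⟩
    · intro σ
      rw [if_pos ((h3 σ).2 σ.surjective)]
      simp only [List.ofFn_injective.eq_iff, eq_comm (a := m)]

theorem FreeAlgebra.lift_eq_sum_coeff {k A : Type*} [CommRing k] [Ring A] [Algebra k A]
    (a : ℕ → A) (f : FreeAlgebra k ℕ) :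
    FreeAlgebra.lift k a f = (FreeAlgebra.equivMonoidAlgebraFreeMonoid f).coeff.sum
      fun u b => b • (u.toList.map a).prod := by
  have : FreeAlgebra.lift k a = (MonoidAlgebra.lift k A (FreeMonoid ℕ) (FreeMonoid.lift a)).comp
      (FreeAlgebra.equivMonoidAlgebraFreeMonoid (R := k) (X := ℕ)).toAlgHom := by
    ext i
    simp [FreeAlgebra.equivMonoidAlgebraFreeMonoid]
  rw [this, AlgHom.comp_apply, MonoidAlgebra.lift_apply]
  simp_rw [FreeMonoid.lift_apply]
  rfl

/-- The multilinear polynomial `∑ σ, c σ • x_{σ 0} ⋯ x_{σ (d - 1)}` vanishes on `R`. -/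
def IsMultilinearIdentity {k : Type*} (R : Type*) [CommRing k] [Ring R] [Algebra k R] {d : ℕ}
    (c : Equiv.Perm (Fin d) → k) : Prop :=
  ∀ z : Fin d → R, ∑ σ, c σ • (List.ofFn (z ∘ σ)).prod = 0

-- Take a longest word `w` among those whose coefficient survives in `A`, and give each position of
-- `w` its own variable, so that repeated letters are polarized. Inclusion-exclusion leaves only
-- rearrangements of `w`, and the identity permutation carries the coefficient of `w` itself.
open Finset in
theorem IsPI.exists_multilinear {k A : Type*} [CommRing k] [Ring A] [Algebra k A]
    (h : IsPI k A) : ∃ (d : ℕ) (c : Equiv.Perm (Fin d) → k),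
      algebraMap k A (c 1) ≠ 0 ∧ IsMultilinearIdentity A c := by
  obtain ⟨f, ⟨w₀, hw₀⟩, hf⟩ := h
  set F := (FreeAlgebra.equivMonoidAlgebraFreeMonoid f).coeff with hF
  classical
  obtain ⟨w, hw, hmax⟩ := Finset.exists_max_image
    (F.support.filter fun u => algebraMap k A (F u) ≠ 0) (fun u => u.toList.length)
    ⟨w₀, by
      simp only [mem_filter, Finsupp.mem_support_iff]
      exact ⟨fun h0 => hw₀ (by rw [h0, map_zero]), hw₀⟩⟩
  simp only [mem_filter, Finsupp.mem_support_iff] at hw hmax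
  refine ⟨w.toList.length, fun σ => F (FreeMonoid.ofList (List.ofFn (w.toList.get ∘ σ))), ?_, ?_⟩
  · simpa using hw.2
  intro z
  have h0 : ∑ S : Finset (Fin w.toList.length), (-1) ^ #S *
      FreeAlgebra.lift k (fun i => ∑ j ∈ S with w.toList.get j = i, z j) f = 0 := by
    simp [hf]
  simp_rw [FreeAlgebra.lift_eq_sum_coeff, ← hF, Finsupp.sum, Finset.mul_sum, mul_smul_comm] at h0
  rw [Finset.sum_comm] at h0
  simp_rw [← Finset.smul_sum] at h0
  have h1 : ∀ u ∈ F.support, F u • ∑ S : Finset (Fin w.toList.length), (-1) ^ #S *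
        (u.toList.map fun i => ∑ j ∈ S with w.toList.get j = i, z j).prod =
      F u • ((-1) ^ w.toList.length * ∑ σ : Equiv.Perm (Fin w.toList.length),
        if u.toList = List.ofFn (w.toList.get ∘ σ) then (List.ofFn (z ∘ σ)).prod else 0) := by
    intro u hu
    -- Words whose coefficient dies in `A` may be longer than `w`, but they contribute nothing.
    by_cases hu' : algebraMap k A (F u) = 0
    · rw [Algebra.smul_def, Algebra.smul_def, hu', zero_mul, zero_mul]
    · rw [sum_neg_one_pow_mul_prod_map _ _ _ (hmax u ⟨Finsupp.mem_support_iff.1 hu, hu'⟩)]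
  rw [Finset.sum_congr rfl h1] at h0
  simp_rw [← mul_smul_comm, ← Finset.mul_sum, Finset.smul_sum] at h0
  rw [Finset.sum_comm] at h0
  have h2 := (((isUnit_one (M := A)).neg.pow w.toList.length).mul_right_eq_zero).1 h0
  rw [← h2]
  refine Finset.sum_congr rfl fun σ _ => ?_
  rw [Finset.sum_eq_single (FreeMonoid.ofList (List.ofFn (w.toList.get ∘ σ)))]
  · simp
  · intro u _ hu
    rw [if_neg, smul_zero]
    intro h
    exact hu (by rw [← h]; rfl)
  · intro hu
    rw [Finsupp.notMem_support_iff.1 hu, zero_smul]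

/-! ### Ore conditions and the division ring of fractions -/

/-- Transfers the left Ore condition to the right. Reversing the variables together with the words
turns `c` into a conjugate by `Fin.revPerm`, so the coefficient at 1 is unchanged. -/
theorem IsMultilinearIdentity.op {k R : Type*} [CommRing k] [Ring R] [Algebra k R] {d : ℕ}
    {c : Equiv.Perm (Fin d) → k} (h : IsMultilinearIdentity R c) :
    IsMultilinearIdentity Rᵐᵒᵖ fun σ => c (Fin.revPerm * σ * Fin.revPerm) := by
  intro z
  have h1 := congrArg MulOpposite.op (h fun i => (z i.rev).unop)
  rw [MulOpposite.op_zero, ← MulOpposite.opAddEquiv_apply, map_sum] at h1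
  rw [← h1]
  refine Fintype.sum_equiv ((Equiv.mulLeft Fin.revPerm).trans (Equiv.mulRight Fin.revPerm)) _ _ ?_
  intro σ
  have h2 : ((List.ofFn (z ∘ σ)).map MulOpposite.unop).reverse =
      List.ofFn ((fun i => (z i.rev).unop) ∘ (Fin.revPerm * σ * Fin.revPerm : Equiv.Perm (Fin d))) := by
    apply List.ext_get
    · simp
    · intro n h1 h2
      simp only [List.get_eq_getElem, List.getElem_reverse, List.getElem_map, List.getElem_ofFn,
        Function.comp, Equiv.Perm.mul_apply, Fin.revPerm_apply, Fin.rev_rev, List.length_map,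
        List.length_ofFn]
      congr 4
      change d - 1 - n = d - (n + 1)
      omega
  simp only [Equiv.trans_apply, Equiv.coe_mulLeft, Equiv.coe_mulRight, MulOpposite.opAddEquiv_apply,
    MulOpposite.op_smul, ← h2, ← MulOpposite.unop_list_prod, MulOpposite.op_unop]

/-- Elements that are left independent generate a free algebra: there is no relation between the
words of length `n` in them. -/
theorem eq_zero_of_sum_mul_word_eq_zero {R ι : Type*} [Ring R] [Fintype ι] (z : ι → R)
    (hz : ∀ x : ι → R, ∑ i, x i * z i = 0 → x = 0) (n : ℕ) (c : (Fin n → ι) → R)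
    (h : ∑ u, c u * (List.ofFn (z ∘ u)).prod = 0) : c = 0 := by
  induction n with
  | zero =>
    ext u
    simpa [Subsingleton.elim u default] using h
  | succ n ih =>
    have h1 : ∑ i, (∑ u : Fin n → ι, c (Fin.snoc u i) * (List.ofFn (z ∘ u)).prod) * z i = 0 := by
      rw [← h, ← (Fin.snocEquiv fun _ => ι).sum_comp, Fintype.sum_prod_type]
      refine Finset.sum_congr rfl fun i _ => ?_
      rw [Finset.sum_mul]
      refine Finset.sum_congr rfl fun u _ => ?_
      rw [List.ofFn_succ']
      simp [Fin.snocEquiv, mul_assoc, Function.comp_def]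
    have h2 := hz _ h1
    ext v
    have h3 := congrFun (ih (fun u => c (Fin.snoc u (v (Fin.last n)))) (congrFun h2 _))
      (fun i => v i.castSucc)
    simpa [← Fin.init_def] using h3

/-- Failure of the Ore condition at `a`, `b` makes the elements a bⁱ left independent: every term
but the first ends in `b`, so `hab` kills `x 0`, and cancelling `b` shifts the index. -/
theorem eq_zero_of_sum_mul_mul_pow_eq_zero {R : Type*} [Ring R] [NoZeroDivisors R] {a b : R}
    (hb : b ≠ 0) (hab : ∀ x y : R, x * a = y * b → x = 0) (n : ℕ) (x : Fin n → R)
    (h : ∑ i, x i * (a * b ^ (i : ℕ)) = 0) : x = 0 := by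
  induction n with
  | zero => exact Subsingleton.elim _ _
  | succ n ih =>
    rw [Fin.sum_univ_succ] at h
    have h1 : x 0 * a = -(∑ i : Fin n, x i.succ * (a * b ^ (i : ℕ))) * b := by
      rw [neg_mul, Finset.sum_mul, eq_neg_iff_add_eq_zero, ← h]
      simp [pow_succ, mul_assoc]
    have h2 := hab _ _ h1
    rw [h2, zero_mul, zero_eq_mul, neg_eq_zero] at h1
    have h3 := ih _ (h1.resolve_right hb)
    ext i
    refine Fin.cases h2 (fun j => congrFun h3 j) i

/-- A domain with a nontrivial multilinear identity satisfies the left Ore condition. -/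
theorem IsMultilinearIdentity.exists_mul_eq_mul {k R : Type*} [CommRing k] [Ring R] [IsDomain R]
    [Algebra k R] {d : ℕ} {c : Equiv.Perm (Fin d) → k} (h : IsMultilinearIdentity R c)
    (hc : algebraMap k R (c 1) ≠ 0) {a b : R} (hb : b ≠ 0) :
    ∃ x y : R, x ≠ 0 ∧ x * a = y * b := by
  by_contra! hab
  have hab' : ∀ x y : R, x * a = y * b → x = 0 := fun x y hxy => by_contra fun hx => hab x y hx hxy
  -- Extended by zero to all maps, `c` becomes a relation between the words of length `d` in the
  -- independent elements a bⁱ.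
  have h1 := eq_zero_of_sum_mul_word_eq_zero (fun i : Fin d => a * b ^ (i : ℕ))
    (eq_zero_of_sum_mul_mul_pow_eq_zero hb hab' d) d
    (Function.extend (fun σ : Equiv.Perm (Fin d) => (σ : Fin d → Fin d))
      (fun σ => algebraMap k R (c σ)) 0) (by
        rw [← h fun i : Fin d => a * b ^ (i : ℕ)]
        symm
        refine Fintype.sum_of_injective (fun σ : Equiv.Perm (Fin d) => (σ : Fin d → Fin d))
          DFunLike.coe_injective _ _ ?_ ?_
        · intro r hr
          rw [Function.extend_apply' _ _ _ hr, Pi.zero_apply, zero_mul]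
        · intro σ
          rw [DFunLike.coe_injective.extend_apply, Algebra.smul_def])
  refine hc ?_
  have h2 := congrFun h1 (1 : Equiv.Perm (Fin d))
  rwa [DFunLike.coe_injective.extend_apply] at h2

/-- A domain with a nontrivial multilinear identity satisfies the right Ore condition. -/
theorem IsMultilinearIdentity.exists_mul_eq_mul' {k R : Type*} [CommRing k] [Ring R] [IsDomain R]
    [Algebra k R] {d : ℕ} {c : Equiv.Perm (Fin d) → k} (h : IsMultilinearIdentity R c)
    (hc : algebraMap k R (c 1) ≠ 0) {a b : R} (hb : b ≠ 0) :
    ∃ x y : R, x ≠ 0 ∧ a * x = b * y := by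
  obtain ⟨x, y, hx, hxy⟩ := h.op.exists_mul_eq_mul (a := .op a) (b := .op b) (by
    have : (Fin.revPerm * 1 * Fin.revPerm : Equiv.Perm (Fin d)) = 1 := by ext; simp
    simpa only [this, ne_eq, MulOpposite.op_eq_zero_iff, MulOpposite.algebraMap_apply] using hc) (by simpa)
  exact ⟨x.unop, y.unop, by simpa using hx, by simpa using congrArg MulOpposite.unop hxy⟩

theorem IsMultilinearIdentity.nonempty_oreSet {k R : Type*} [CommRing k] [Ring R] [IsDomain R]
    [Algebra k R] {d : ℕ} {c : Equiv.Perm (Fin d) → k} (h : IsMultilinearIdentity R c)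
    (hc : algebraMap k R (c 1) ≠ 0) : Nonempty (OreLocalization.OreSet (nonZeroDivisors R)) := by
  rw [OreLocalization.nonempty_oreSet_iff_of_noZeroDivisors]
  intro r s
  obtain ⟨x, y, hx, hxy⟩ := h.exists_mul_eq_mul hc (a := r) (nonZeroDivisors.ne_zero s.2)
  exact ⟨y, ⟨x, mem_nonZeroDivisors_of_ne_zero hx⟩, hxy⟩

/-- The canonical map to the Ore localization at all nonzero elements. -/
def oreFractionHom (k R : Type*) [CommRing k] [Ring R] [IsDomain R] [Algebra k R]
    [OreLocalization.OreSet (nonZeroDivisors R)] :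
    R →ₐ[k] OreLocalization (nonZeroDivisors R) R :=
  { OreLocalization.numeratorRingHom with
    commutes' := fun _ => rfl }

theorem isFractionDivisionRing_oreFractionHom {k R : Type*} [CommRing k] [Ring R] [IsDomain R]
    [Algebra k R] [OreLocalization.OreSet (nonZeroDivisors R)]
    (hR : ∀ a b : R, b ≠ 0 → ∃ x y : R, x ≠ 0 ∧ a * x = b * y) :
    IsFractionDivisionRing (oreFractionHom k R) := by
  have hinj : Function.Injective (oreFractionHom k R) :=
    OreLocalization.numeratorHom_inj fun _ h => h.1
  have hleft : ∀ q, ∃ s a : R, s ≠ 0 ∧ q = (oreFractionHom k R s)⁻¹ * oreFractionHom k R a := by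
    intro q
    induction q using OreLocalization.ind with
    | _ r s =>
      have hs := nonZeroDivisors.ne_zero s.2
      refine ⟨s, r, hs, ?_⟩
      rw [eq_inv_mul_iff_mul_eq₀ ((map_ne_zero_iff _ hinj).2 hs)]
      exact OreLocalization.mul_cancel
  refine ⟨hinj, hleft, fun q => ?_⟩
  obtain ⟨s, a, hs, rfl⟩ := hleft q
  obtain ⟨x, y, hx, hxy⟩ := hR a s hs
  refine ⟨y, x, hx, ?_⟩
  rw [eq_mul_inv_iff_mul_eq₀ ((map_ne_zero_iff _ hinj).2 hx), mul_assoc,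
    inv_mul_eq_iff_eq_mul₀ ((map_ne_zero_iff _ hinj).2 hs), ← map_mul, ← map_mul, hxy]

/-! ### Identities of the division ring of fractions -/

/-- A linear generalized polynomial vanishing on a domain vanishes on its division ring of
fractions. -/
theorem IsFractionDivisionRing.sum_mul_mul_eq_zero {k A Q I : Type*} [CommRing k] [Ring A]
    [Algebra k A] [DivisionRing Q] [Algebra k Q] {f : A →ₐ[k] Q} (hf : IsFractionDivisionRing f)
    (s : Finset I) (p q : I → Q) (h : ∀ x : A, ∑ i ∈ s, p i * f x * q i = 0) (y : Q) :
    ∑ i ∈ s, p i * y * q i = 0 := by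
  classical
  induction s using Finset.induction_on generalizing p y with
  | empty => simp
  | insert j s hj ih =>
    by_cases hp : p j = 0
    · simp only [Finset.sum_insert hj, hp, zero_mul, zero_add] at h ⊢
      exact ih p h y
    set φ : Q → Q := fun y => ∑ i ∈ insert j s, (p j)⁻¹ * p i * y * q i with hφ
    have hφf (x : A) : φ (f x) = 0 := by
      simp only [hφ, mul_assoc, ← Finset.mul_sum]
      simp only [← mul_assoc, h x, mul_zero]
    -- The coefficient at `j` is now 1, so the `j` term cancels in this commutator, and the
    -- induction hypothesis applies to the shorter sum. Thus φ is left linear over `A`; it vanishes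
    -- on `A`, hence on fractions.
    have hA (a : A) (y : Q) : φ (f a * y) = f a * φ y := by
      have h1 (y : Q) : φ (f a * y) - f a * φ y =
          ∑ i ∈ s, ((p j)⁻¹ * p i * f a - f a * ((p j)⁻¹ * p i)) * y * q i := by
        simp only [hφ, Finset.sum_insert hj, mul_add, Finset.mul_sum,
          sub_mul, Finset.sum_sub_distrib, mul_assoc, inv_mul_cancel_left₀ hp]
        abel
      rw [← sub_eq_zero, h1]
      refine ih _ (fun x => ?_) y
      rw [← h1, ← map_mul, hφf, hφf, mul_zero, sub_zero]
    have hQ (y : Q) : φ y = 0 := by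
      obtain ⟨t, a, ht, rfl⟩ := hf.left_fraction y
      have ht' : f t ≠ 0 := (map_ne_zero_iff _ hf.injective).2 ht
      have h1 := hA t ((f t)⁻¹ * f a)
      rw [mul_inv_cancel_left₀ ht', hφf, zero_eq_mul] at h1
      exact h1.resolve_left ht'
    have h2 := congrArg (p j * ·) (hQ y)
    simpa only [hφ, Finset.mul_sum, mul_zero, ← mul_assoc, mul_inv_cancel₀ hp, one_mul] using h2

theorem List.exists_prod_map_update_eq {R ι : Type*} [Ring R] [DecidableEq ι] (z : ι → R) (i : ι)
    {l : List ι} (hl : l.Nodup) (hi : i ∈ l) :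
    ∃ p q : R, ∀ y, (l.map (Function.update z i y)).prod = p * y * q := by
  obtain ⟨l₁, l₂, rfl⟩ := List.append_of_mem hi
  rw [List.nodup_middle, List.nodup_cons, List.mem_append, not_or] at hl
  refine ⟨(l₁.map z).prod, (l₂.map z).prod, fun y => ?_⟩
  have h (m : List ι) (hm : i ∉ m) : m.map (Function.update z i y) = m.map z :=
    List.map_congr_left fun j hj => Function.update_of_ne (by rintro rfl; exact hm hj) _ _
  simp [h _ hl.1.1, h _ hl.1.2, mul_assoc]

/-- The arguments are freed from `A` one at a time: with the others fixed, the identity is a sum ∑ p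
y q in a single variable. -/
theorem IsMultilinearIdentity.fractions {k A Q : Type*} [CommRing k] [Ring A] [Algebra k A]
    [DivisionRing Q] [Algebra k Q] {f : A →ₐ[k] Q} (hf : IsFractionDivisionRing f) {d : ℕ}
    {c : Equiv.Perm (Fin d) → k} (h : IsMultilinearIdentity A c) : IsMultilinearIdentity Q c := by
  suffices H : ∀ (s : Finset (Fin d)) (z : Fin d → Q), (∀ i ∉ s, z i ∈ Set.range f) →
      ∑ σ, c σ • (List.ofFn (z ∘ σ)).prod = 0 from
    fun z => H Finset.univ z fun i hi => (hi (Finset.mem_univ i)).elim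
  intro s
  induction s using Finset.induction_on with
  | empty =>
    intro z hz
    choose w hw using fun i => hz i (Finset.notMem_empty i)
    obtain rfl : f ∘ w = z := funext hw
    have := congrArg f (h w)
    simpa [map_sum, map_list_prod, List.map_ofFn, Function.comp_assoc] using this
  | insert i s hi ih =>
    intro z hz
    have h1 (σ : Equiv.Perm (Fin d)) : ∃ p q : Q, ∀ y,
        (List.ofFn (Function.update z i y ∘ σ)).prod = p * y * q := by
      obtain ⟨p, q, hpq⟩ := List.exists_prod_map_update_eq z i (l := List.ofFn σ)
        (List.nodup_ofFn.2 σ.injective) (List.mem_ofFn.2 ⟨σ.symm i, by simp⟩)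
      exact ⟨p, q, fun y => by rw [← hpq, List.map_ofFn]⟩
    choose p q hpq using h1
    have h2 (y : Q) : ∑ σ, c σ • (List.ofFn (Function.update z i y ∘ σ)).prod =
        ∑ σ, c σ • p σ * y * q σ := by simp only [hpq, smul_mul_assoc]
    have h3 := h2 (z i)
    rw [Function.update_eq_self] at h3
    rw [h3]
    refine hf.sum_mul_mul_eq_zero _ _ _ (fun x => ?_) _
    rw [← h2]
    refine ih _ fun j hj => ?_
    by_cases hij : j = i
    · subst hij
      simp
    · rw [Function.update_of_ne hij]
      exact hz j (by simp [hij, hj])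

/-! ### Kaplansky's theorem for division rings -/

/-- The `K`-linear operators on `D` spanned by the right multiplications. -/
def rightMulSpan (K D : Type*) [Field K] [DivisionRing D] [Module K D] [IsScalarTower K D D] :
    Submodule K (Module.End K D) :=
  Submodule.span K (Set.range (LinearMap.mulRight K))

/-- Each `T i` moves `v i` one step up and kills the other vectors, so from `v j` only the letters
j, j + 1, … in this order survive. In the opposite ring the leftmost factor acts first. -/
theorem unop_prod_map_apply_of_staircase {K D : Type*} [Field K] [DivisionRing D] [Module K D]
    {v : ℕ → D} {d : ℕ} {T : ℕ → (Module.End K D)ᵐᵒᵖ}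
    (hT : ∀ i < d, ∀ j ≤ d, (T i).unop (v j) = if i = j then v (j + 1) else 0) (l : List ℕ) (j : ℕ)
    (hl : ∀ i ∈ l, i < d) (hj : j + l.length ≤ d) :
    (l.map T).prod.unop (v j) = if l = List.range' j l.length then v (j + l.length) else 0 := by
  induction l generalizing j with
  | nil => simp
  | cons i l ih =>
    simp only [List.length_cons] at hj
    simp only [List.map_cons, List.prod_cons, MulOpposite.unop_mul, Module.End.mul_apply,
      List.length_cons, List.range'_succ, List.cons.injEq]
    rw [hT i (hl i (by simp)) j (by omega)]
    by_cases hij : i = j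
    · rw [if_pos hij, ih (j + 1) (fun i hi => hl i (by simp [hi])) (by omega)]
      simp only [hij, true_and]
      congr 2
      omega
    · simp [hij]

section Density

variable {K D : Type*} [Field K] [DivisionRing D] [Module K D] [IsScalarTower K D D]

theorem mulRight_mul_mem_rightMulSpan (b : D) {T : Module.End K D} (hT : T ∈ rightMulSpan K D) :
    LinearMap.mulRight K b * T ∈ rightMulSpan K D := by
  induction hT using Submodule.span_induction with
  | mem T hT =>
    obtain ⟨a, rfl⟩ := hT
    exact Submodule.subset_span ⟨a * b, by ext; simp [mul_assoc]⟩
  | zero => simp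
  | add T U _ _ hT hU => rw [mul_add]; exact add_mem hT hU
  | smul c T _ hT => rw [mul_smul_comm]; exact Submodule.smul_mem _ _ hT

/-- Jacobson density for the right multiplications on a division ring `D` and a maximal
subfield `K`. -/
theorem exists_rightMulSpan_apply_ne_zero
    (hK : ∀ c : D, (∀ r : K, c * (r • 1) = r • c) → ∃ r : K, c = r • 1)
    {V : Submodule K D} (hV : V.FG) {v : D} (hv : v ∉ V) :
    ∃ T ∈ rightMulSpan K D, (∀ x ∈ V, T x = 0) ∧ T v ≠ 0 := by
  suffices H : ∀ s : Finset D, ∀ v ∉ Submodule.span K (s : Set D),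
      ∃ T ∈ rightMulSpan K D, (∀ x ∈ s, T x = 0) ∧ T v ≠ 0 by
    obtain ⟨s, rfl⟩ := hV
    obtain ⟨T, hT, hs, hTv⟩ := H s v hv
    refine ⟨T, hT, fun x hx => ?_, hTv⟩
    exact (Submodule.span_le (p := LinearMap.ker T)).2 hs hx
  classical
  intro s
  induction s using Finset.induction_on with
  | empty =>
    intro v hv
    refine ⟨LinearMap.mulRight K 1, Submodule.subset_span ⟨1, rfl⟩, by simp, ?_⟩
    simpa using hv
  | insert u s _ ih =>
    intro v hv
    rw [Finset.coe_insert] at hv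
    by_contra! hno
    have hus : u ∉ Submodule.span K (s : Set D) := by
      intro hu
      rw [Submodule.span_insert_eq_span hu] at hv
      obtain ⟨T, hT, hs, hTv⟩ := ih v hv
      refine hTv (hno T hT fun x hx => ?_)
      rcases Finset.mem_insert.1 hx with rfl | hx
      · exact (Submodule.span_le (p := LinearMap.ker T)).2 hs hu
      · exact hs x hx
    have hno' (T) (hT : T ∈ rightMulSpan K D) (hs : ∀ x ∈ s, T x = 0) (hu : T u = 0) : T v = 0 :=
      hno T hT fun x hx => (Finset.mem_insert.1 hx).elim (fun h => h ▸ hu) (hs x)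
    have hwd {T U} (hT : T ∈ rightMulSpan K D) (hTs : ∀ x ∈ s, T x = 0)
        (hU : U ∈ rightMulSpan K D) (hUs : ∀ x ∈ s, U x = 0) (hu : T u = U u) : T v = U v := by
      have := hno' (T - U) (sub_mem hT hU) (fun x hx => by simp [hTs x hx, hUs x hx])
        (by simp [hu])
      simpa [sub_eq_zero] using this
    obtain ⟨T₀, hT₀, hs₀, hu₀⟩ := ih u hus
    set T₁ := LinearMap.mulRight K (T₀ u)⁻¹ * T₀ with hT₁
    have hT₁m : T₁ ∈ rightMulSpan K D := mulRight_mul_mem_rightMulSpan _ hT₀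
    have hT₁s : ∀ x ∈ s, T₁ x = 0 := fun x hx => by simp [hT₁, hs₀ x hx]
    have hT₁u : T₁ u = 1 := by simp [hT₁, hu₀]
    -- Among operators killing `s`, the value at `v` depends only on the value at `u`, so it is left
    -- multiplication of `T u` by `T₁ v`. Testing on multiples of `T₁` shows that `T₁ v` commutes
    -- with `K`, so it is some `r` in `K`; then v - r u is killed too and lies in the span of `s`.
    have key {T} (hT : T ∈ rightMulSpan K D) (hTs : ∀ x ∈ s, T x = 0) : T v = T₁ v * T u := by
      have := hwd hT hTs (mulRight_mul_mem_rightMulSpan (T u) hT₁m)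
        (fun x hx => by simp [hT₁s x hx]) (by simp [hT₁u])
      simpa using this
    obtain ⟨r, hr⟩ := hK (T₁ v) fun r => by
      have := key (Submodule.smul_mem _ r hT₁m) fun x hx => by simp [hT₁s x hx]
      simpa [hT₁u] using this.symm
    have hvs : v - r • u ∈ Submodule.span K (s : Set D) := by
      by_contra hc
      obtain ⟨T, hT, hs, hTv⟩ := ih _ hc
      apply hTv
      rw [map_sub, map_smul, key hT hs, hr, smul_mul_assoc, one_mul, sub_self]
    apply hv
    rw [Submodule.mem_span_insert]
    exact ⟨r, _, hvs, by abel⟩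

/-- Right multiplications reverse products, hence the opposite ring. They satisfy the identity,
which extends to their `K`-span by multilinearity. -/
theorem sum_smul_prod_eq_zero_of_mem_rightMulSpan {d : ℕ} {c : Equiv.Perm (Fin d) → K}
    (hc : ∀ (a : D) (z : Fin d → D), ∑ σ, c σ • (a * (List.ofFn (z ∘ σ)).prod) = 0)
    (T : Fin d → (Module.End K D)ᵐᵒᵖ) (hT : ∀ i, (T i).unop ∈ rightMulSpan K D) :
    ∑ σ, c σ • (List.ofFn (T ∘ σ)).prod = 0 := by
  let ρ : D →* (Module.End K D)ᵐᵒᵖ :=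
    { toFun := fun a => .op (LinearMap.mulRight K a)
      map_one' := by
        rw [LinearMap.mulRight_one]
        rfl
      map_mul' := fun a b => by
        rw [← MulOpposite.op_mul]
        congr 1
        ext
        simp [mul_assoc] }
  let L : (D →₀ K) →ₗ[K] (Module.End K D)ᵐᵒᵖ := Finsupp.linearCombination K ρ
  have hL (i) : ∃ x, L x = T i := by
    have h1 := hT i
    rw [rightMulSpan, Finsupp.mem_span_range_iff_exists_finsupp] at h1
    obtain ⟨x, hx⟩ := h1
    refine ⟨x, ?_⟩
    rw [← MulOpposite.unop_inj, ← hx, Finsupp.linearCombination_apply, Finsupp.sum, Finsupp.sum,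
      ← MulOpposite.opAddEquiv_symm_apply, map_sum]
    rfl
  choose x hx using hL
  let G : MultilinearMap K (fun _ : Fin d => D →₀ K) (Module.End K D)ᵐᵒᵖ :=
    (∑ σ, c σ • (MultilinearMap.mkPiAlgebraFin K d (Module.End K D)ᵐᵒᵖ).domDomCongr σ).compLinearMap
      fun _ => L
  have hG (y) : G y = ∑ σ, c σ • (List.ofFn ((fun i => L (y i)) ∘ σ)).prod := by
    simp [G, Function.comp_def]
  have hG0 : G = 0 := by
    refine Module.Basis.ext_multilinear (fun _ => Finsupp.basisSingleOne) fun z => ?_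
    rw [hG, _root_.zero_apply]
    have h1 (σ : Equiv.Perm (Fin d)) :
        (List.ofFn ((fun i => L (Finsupp.basisSingleOne (z i))) ∘ σ)).prod =
        ρ (List.ofFn (z ∘ σ)).prod := by
      rw [map_list_prod, List.map_ofFn]
      congr 2
      ext1 i
      simp [L]
    simp_rw [h1]
    rw [← MulOpposite.unop_inj]
    ext a
    rw [← MulOpposite.opAddEquiv_symm_apply, map_sum]
    simpa [ρ] using hc a z
  have := hG x
  rw [hG0, _root_.zero_apply] at this
  simpa only [hx] using this.symm

/-- Given d + 1 independent vectors, density supplies staircase operators in the span of the right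
multiplications. Evaluated on them at `v 0`, the identity leaves only `c 1 • v d`, which is nonzero.
-/
theorem rank_le_of_multilinear_identity
    (hK : ∀ c : D, (∀ r : K, c * (r • 1) = r • c) → ∃ r : K, c = r • 1)
    {d : ℕ} {c : Equiv.Perm (Fin d) → K}
    (hc : ∀ (a : D) (z : Fin d → D), ∑ σ, c σ • (a * (List.ofFn (z ∘ σ)).prod) = 0)
    (hc1 : c 1 ≠ 0) : Module.rank K D ≤ d := by
  refine rank_le fun s hs => ?_
  by_contra! hd
  let e : Fin (d + 1) ↪ s := (Fin.castLEEmb (by omega)).trans s.equivFin.symm.toEmbedding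
  have hv : LinearIndependent K fun j => (e j : D) := hs.comp e e.injective
  let v : ℕ → D := fun j => if h : j < d + 1 then e ⟨j, h⟩ else 0
  have hve (j : Fin (d + 1)) : v j = e j := dif_pos j.2
  have hT (i : ℕ) (hi : i < d) : ∃ T ∈ rightMulSpan K D,
      ∀ j ≤ d, T (v j) = if i = j then v (j + 1) else 0 := by
    have hi' := hv.notMem_span_image (s := {(⟨i, by omega⟩ : Fin (d + 1))}ᶜ)
      (x := ⟨i, by omega⟩) (by simp)
    obtain ⟨T, hT, hTV, hTv⟩ := exists_rightMulSpan_apply_ne_zero hK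
      (Submodule.fg_span ((Set.toFinite _).image _)) hi'
    refine ⟨_, mulRight_mul_mem_rightMulSpan ((T (v i))⁻¹ * v (i + 1)) hT, fun j hj => ?_⟩
    have hjv := hve ⟨j, by omega⟩
    by_cases hij : i = j
    · subst hij
      rw [← hjv] at hTv
      simp only [Module.End.mul_apply, LinearMap.mulRight_apply, if_true]
      exact mul_inv_cancel_left₀ hTv _
    · rw [if_neg hij, Module.End.mul_apply, hTV (v j), map_zero]
      rw [show v j = _ from hjv]
      exact Submodule.subset_span ⟨_, by simpa [eq_comm] using hij, rfl⟩
  choose! T hTm hT using hT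
  have h1 := sum_smul_prod_eq_zero_of_mem_rightMulSpan hc (fun i : Fin d => .op (T i))
    fun i => hTm i i.2
  have h2 (σ : Equiv.Perm (Fin d)) :
      (List.ofFn ((fun i : Fin d => MulOpposite.op (T i)) ∘ σ)).prod.unop (v 0) =
        if σ = 1 then v d else 0 := by
    have h3 := unop_prod_map_apply_of_staircase (v := v) (d := d) (T := fun i => .op (T i))
      (fun i hi j hj => hT i hi j hj) (List.ofFn fun i => (σ i : ℕ)) 0
      (by simp [List.mem_ofFn]) (by simp)
    rw [List.map_ofFn] at h3
    refine Eq.trans h3 ?_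
    have h4 : (List.ofFn fun i => (σ i : ℕ)) = List.range' 0 d ↔ σ = 1 := by
      have h5 : List.range' 0 d = List.ofFn fun i : Fin d => (i : ℕ) :=
        List.ext_get (by simp) (by simp)
      rw [h5, List.ofFn_injective.eq_iff, funext_iff, Equiv.ext_iff]
      simp [Fin.ext_iff]
    simp [h4]
  have h3 := congrArg (fun U : (Module.End K D)ᵐᵒᵖ => U.unop (v 0)) h1
  simp only [MulOpposite.unop_zero, LinearMap.zero_apply] at h3
  rw [← MulOpposite.opAddEquiv_symm_apply, map_sum, LinearMap.sum_apply] at h3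
  simp only [MulOpposite.opAddEquiv_symm_apply, MulOpposite.unop_smul, LinearMap.smul_apply, h2,
    smul_ite, smul_zero, Finset.sum_ite_eq', Finset.mem_univ, if_true] at h3
  refine (smul_ne_zero hc1 ?_) h3
  exact (hve (Fin.last d)).trans_ne (hv.ne_zero _)

end Density

/-- Linear generalized polynomials over a division ring, with right coefficients independent over
the center, vanish only trivially. -/
theorem eq_zero_of_sum_mul_mul_eq_zero {C D I : Type*} [Field C] [DivisionRing D] [Algebra C D]
    [Algebra.IsCentral C D] (s : Finset I) (p b : I → D) (hb : LinearIndepOn C b s)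
    (h : ∀ x : D, ∑ i ∈ s, p i * x * b i = 0) : ∀ i ∈ s, p i = 0 := by
  classical
  induction s using Finset.induction_on generalizing p with
  | empty => simp
  | insert j s hj ih =>
    have hbs : LinearIndepOn C b s := hb.mono (by simp)
    suffices hp : p j = 0 by
      simp only [Finset.sum_insert hj, hp, zero_mul, zero_add] at h
      intro i hi
      rcases Finset.mem_insert.1 hi with rfl | hi
      · exact hp
      · exact ih p hbs h i hi
    by_contra hp
    have h' (x : D) : ∑ i ∈ insert j s, (p j)⁻¹ * p i * x * b i = 0 := by
      simp only [mul_assoc, ← Finset.mul_sum]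
      simp only [← mul_assoc, h x, mul_zero]
    have h1 : ∀ i ∈ insert j s, ∃ r : C, (p j)⁻¹ * p i = algebraMap C D r := by
      intro i hi
      suffices hc : (p j)⁻¹ * p i ∈ Subalgebra.center C D by
        rw [Algebra.IsCentral.center_eq_bot] at hc
        obtain ⟨r, hr⟩ := Algebra.mem_bot.1 hc
        exact ⟨r, hr.symm⟩
      rcases Finset.mem_insert.1 hi with rfl | hi
      · rw [inv_mul_cancel₀ hp]
        exact one_mem _
      rw [Subalgebra.mem_center_iff]
      intro a
      have h2 := ih (fun i => (p j)⁻¹ * p i * a - a * ((p j)⁻¹ * p i)) hbs (fun x => ?_) i hi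
      · exact (sub_eq_zero.1 h2).symm
      have h3 := h' (a * x)
      have h4 := congrArg (a * ·) (h' x)
      simp only [Finset.sum_insert hj, mul_zero, mul_add, Finset.mul_sum, mul_assoc,
        inv_mul_cancel_left₀ hp] at h3 h4
      simp only [sub_mul, Finset.sum_sub_distrib, mul_assoc]
      rw [sub_eq_zero]
      exact add_left_cancel (h3.trans h4.symm)
    choose! r hr using h1
    have h2 := h' 1
    rw [Finset.sum_congr rfl fun i hi => by rw [hr i hi, mul_one, ← Algebra.smul_def]] at h2
    have h3 := linearIndepOn_finset_iff.1 hb r h2 j (Finset.mem_insert_self j s)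
    have h4 := hr j (Finset.mem_insert_self j s)
    rw [h3, map_zero, inv_mul_cancel₀ hp] at h4
    exact one_ne_zero h4

/-- Zorn's lemma gives a maximal commuting set; in a division ring it is a maximal subfield. -/
theorem exists_set_centralizer_eq_self (D : Type*) [Ring D] : ∃ S : Set D, S.centralizer = S := by
  obtain ⟨S, hS⟩ := zorn_subset {S : Set D | S ⊆ S.centralizer} (by
    intro c hc hchain
    refine ⟨⋃₀ c, ?_, fun s hs => Set.subset_sUnion_of_mem hs⟩
    rintro x ⟨s, hs, hx⟩ y ⟨t, ht, hy⟩
    rcases hchain.total hs ht with h | h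
    · exact hc ht (h hx) y hy
    · exact hc hs hx y (h hy))
  refine ⟨S, subset_antisymm (fun x hx => ?_) hS.prop⟩
  refine hS.le_of_ge (y := insert x S) ?_ (Set.subset_insert x S) (Set.mem_insert x S)
  rintro y (rfl | hy) z (rfl | hz)
  · rfl
  · exact hx z hz
  · exact (hx y hy).symm
  · exact hS.prop hy z hz

/-- Elements independent over the center give right multiplications independent over `K`, inside the
finite-dimensional space of `K`-endomorphisms of `D`. -/
theorem finiteDimensional_of_finiteDimensional_subfield {C K D : Type*} [Field C] [Field K]
    [DivisionRing D] [Algebra C D] [Algebra.IsCentral C D] [Module K D] [IsScalarTower K D D]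
    [FiniteDimensional K D] : FiniteDimensional C D := by
  suffices h : Module.rank C D ≤ (Module.finrank K (Module.End K D) : ℕ) from
    Module.rank_lt_aleph0_iff.1 (h.trans_lt Cardinal.natCast_lt_aleph0)
  refine rank_le fun s hs => ?_
  let L : (s → K) →ₗ[K] Module.End K D :=
    Fintype.linearCombination K fun b : s => LinearMap.mulRight K (b : D)
  have hL : Function.Injective L := by
    rw [injective_iff_map_eq_zero]
    intro r hr
    have h1 := eq_zero_of_sum_mul_mul_eq_zero (C := C) Finset.univ (fun b : s => r b • (1 : D))
      (fun b => (b : D)) (hs.comp _ Subtype.val_injective) fun x => by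
        simpa [L, smul_mul_assoc, Fintype.linearCombination_apply] using LinearMap.congr_fun hr x
    ext b
    simpa using h1 b (Finset.mem_univ b)
  simpa using LinearMap.finrank_le_finrank_of_injective hL

/-- Kaplansky's theorem for division rings: a division ring with a nontrivial multilinear identity
is finite dimensional over its center. -/
theorem IsMultilinearIdentity.finiteDimensional {C D : Type*} [Field C] [DivisionRing D]
    [Algebra C D] [Algebra.IsCentral C D] {d : ℕ} {c : Equiv.Perm (Fin d) → C}
    (h : IsMultilinearIdentity D c) (hc : c 1 ≠ 0) : FiniteDimensional C D := by
  obtain ⟨S, hS⟩ := exists_set_centralizer_eq_self D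
  let K := Subalgebra.centralizer C S
  have hmem (x : D) : x ∈ K ↔ x ∈ S := by
    change x ∈ S.centralizer ↔ _
    rw [hS]
  have hcomm (x y : D) (hx : x ∈ K) (hy : y ∈ K) : x * y = y * x :=
    hy x ((hmem x).1 hx)
  let _ : Field K :=
    { (inferInstance : Ring K) with
      mul_comm := fun x y => Subtype.ext (hcomm _ _ x.2 y.2)
      inv := fun x => ⟨(x : D)⁻¹, Set.inv_mem_centralizer₀ x.2⟩
      exists_pair_ne := exists_pair_ne K
      mul_inv_cancel := fun x hx => Subtype.ext (mul_inv_cancel₀ fun h0 => hx (Subtype.ext h0))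
      inv_zero := Subtype.ext inv_zero
      nnqsmul := _
      qsmul := _ }
  have hr := rank_le_of_multilinear_identity (K := K) (D := D) (c := fun σ => algebraMap C K (c σ))
    (fun x hx => by
      have : x ∈ K := by
        intro y hy
        have h1 := hx ⟨y, (hmem y).2 hy⟩
        simpa [Subalgebra.smul_def] using h1.symm
      exact ⟨⟨x, this⟩, by simp [Subalgebra.smul_def]⟩)
    (fun a z => by
      have h1 := congrArg (a * ·) (h z)
      simpa [Finset.mul_sum] using h1)
    (by simpa using hc)
  have : FiniteDimensional K D :=
    Module.rank_lt_aleph0_iff.1 (hr.trans_lt Cardinal.natCast_lt_aleph0)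
  exact finiteDimensional_of_finiteDimensional_subfield (K := K)

/-! ### Derivations of domains of characteristic zero -/

section Leibniz

variable {k R : Type*} [CommRing k] [Ring R] [Algebra k R] {δ : R →ₗ[k] R}

theorem map_one_eq_zero_of_leibniz (h : ∀ a b, δ (a * b) = δ a * b + a * δ b) : δ 1 = 0 := by
  simpa using h 1 1

theorem map_algebraMap_eq_zero_of_leibniz (h : ∀ a b, δ (a * b) = δ a * b + a * δ b) (r : k) :
    δ (algebraMap k R r) = 0 := by
  rw [Algebra.algebraMap_eq_smul_one, map_smul, map_one_eq_zero_of_leibniz h, smul_zero]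

theorem map_mem_center_of_leibniz (h : ∀ a b, δ (a * b) = δ a * b + a * δ b) {z : R}
    (hz : z ∈ Subring.center R) : δ z ∈ Subring.center R := by
  rw [Subring.mem_center_iff] at hz ⊢
  intro a
  have h1 := congrArg δ (hz a)
  rw [h, h, hz, add_comm] at h1
  exact add_right_cancel h1

/-- The leading term of the Leibniz formula. -/
theorem pow_add_apply_mul_of_leibniz (h : ∀ a b, δ (a * b) = δ a * b + a * δ b) {n m : ℕ} {a b : R}
    (ha : (δ ^ (n + 1)) a = 0) (hb : (δ ^ (m + 1)) b = 0) :
    (δ ^ (n + m)) (a * b) = (n + m).choose n • ((δ ^ n) a * (δ ^ m) b) := by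
  induction hN : n + m generalizing n m a b with
  | zero =>
    obtain ⟨rfl, rfl⟩ : n = 0 ∧ m = 0 := by omega
    simp
  | succ N ih =>
    rw [pow_succ, Module.End.mul_apply, h, map_add]
    rcases n with _ | n
    · obtain rfl : m = N + 1 := by omega
      have ha' : δ a = 0 := by simpa using ha
      have h1 := ih (n := 0) (m := N) (a := a) (b := δ b) ha
        (by rwa [← Module.End.mul_apply, ← pow_succ]) (by omega)
      rw [ha', zero_mul, map_zero, zero_add, h1]
      simp [pow_succ]
    rcases m with _ | m
    · obtain rfl : n = N := by omega
      have hb' : δ b = 0 := by simpa using hb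
      have h1 := ih (n := n) (m := 0) (a := δ a) (b := b)
        (by rwa [← Module.End.mul_apply, ← pow_succ]) hb (by omega)
      rw [hb', mul_zero, map_zero, add_zero, h1]
      simp [pow_succ]
    · have h1 := ih (n := n) (m := m + 1) (a := δ a) (b := b)
        (by rwa [← Module.End.mul_apply, ← pow_succ]) hb (by omega)
      have h2 := ih (n := n + 1) (m := m) (a := a) (b := δ b) ha
        (by rwa [← Module.End.mul_apply, ← pow_succ]) (by omega)
      rw [h1, h2, ← Module.End.mul_apply, ← pow_succ, ← Module.End.mul_apply, ← pow_succ,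
        ← add_smul, Nat.choose_succ_succ]

theorem exists_pow_apply_ne_zero {a : R} (ha : a ≠ 0) (hδ : ∃ n, (δ ^ n) a = 0) :
    ∃ n, (δ ^ n) a ≠ 0 ∧ (δ ^ (n + 1)) a = 0 := by
  classical
  have h0 : Nat.find hδ ≠ 0 := fun h => ha (by simpa [h] using Nat.find_spec hδ)
  obtain ⟨n, hn⟩ := Nat.exists_eq_succ_of_ne_zero h0
  exact ⟨n, Nat.find_min hδ (by omega), by simpa [hn] using Nat.find_spec hδ⟩

theorem pow_apply_eq_zero_of_le {a : R} {n m : ℕ} (h : (δ ^ n) a = 0) (hnm : n ≤ m) :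
    (δ ^ m) a = 0 := by
  rw [← Nat.sub_add_cancel hnm, pow_add, Module.End.mul_apply, h, map_zero]

/-- A locally nilpotent derivation of a domain of characteristic zero kills every element that
divides its own derivative. -/
theorem IsLND.apply_eq_zero_of_eq_mul [IsDomain R] [CharZero R] (hδ : IsLND k δ) {u g : R}
    (h : δ u = u * g) : δ u = 0 := by
  by_contra hu
  have hu0 : u ≠ 0 := by rintro rfl; simp at hu
  have hg0 : g ≠ 0 := by rintro rfl; simp [h] at hu
  obtain ⟨n, hn, hn'⟩ := exists_pow_apply_ne_zero hu0 (hδ.locallyNilpotent u)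
  obtain ⟨m, hm, hm'⟩ := exists_pow_apply_ne_zero hg0 (hδ.locallyNilpotent g)
  -- The leading term makes δ^(n + m) nonzero on u g, yet u g = δ u is already killed by δ^n.
  have h1 := pow_add_apply_mul_of_leibniz hδ.leibniz hn' hm'
  rw [← h] at h1
  have h2 : (δ ^ (n + m)) (δ u) = 0 := by
    rw [← Module.End.mul_apply, ← pow_succ]
    exact pow_apply_eq_zero_of_le hn' (by omega)
  rw [h2, eq_comm, smul_eq_zero] at h1
  rcases h1 with h1 | h1
  · exact (Nat.choose_pos (Nat.le_add_right n m)).ne' h1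
  · exact mul_ne_zero hn hm h1

/-- A nilpotent derivation of a domain of characteristic zero is zero. -/
theorem eq_zero_of_leibniz_of_pow_eq_zero [IsDomain R] [CharZero R]
    (h : ∀ a b, δ (a * b) = δ a * b + a * δ b) {N : ℕ} (hN : δ ^ N = 0) : δ = 0 := by
  classical
  by_contra h0
  have hex : ∃ N, δ ^ N = 0 := ⟨N, hN⟩
  have hspec := Nat.find_spec hex
  obtain ⟨n, hn⟩ : ∃ n, Nat.find hex = n + 2 := by
    rcases hf : Nat.find hex with _ | _ | n
    · rw [hf, pow_zero] at hspec
      exact (h0 (by rw [← one_mul δ, hspec, zero_mul])).elim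
    · rw [hf, zero_add, pow_one] at hspec
      exact (h0 hspec).elim
    · exact ⟨n, rfl⟩
  rw [hn] at hspec
  obtain ⟨a, ha⟩ : ∃ a, (δ ^ (n + 1)) a ≠ 0 := by
    by_contra! hc
    exact Nat.find_min hex (m := n + 1) (by omega) (LinearMap.ext hc)
  have ha' : (δ ^ (n + 1 + 1)) a = 0 := by rw [hspec, LinearMap.zero_apply]
  -- With n + 2 the least exponent killing δ, the power 2n + 2 kills a² as well, although its
  -- leading term is a nonzero multiple of the square of δ^(n + 1) a.
  have h1 := pow_add_apply_mul_of_leibniz h ha' ha'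
  rw [pow_apply_eq_zero_of_le (n := n + 2) (by rw [hspec, LinearMap.zero_apply]) (by omega),
    eq_comm, smul_eq_zero] at h1
  rcases h1 with h1 | h1
  · exact (Nat.choose_pos (Nat.le_add_right _ _)).ne' h1
  · exact mul_ne_zero ha ha h1

theorem map_inv_of_leibniz {Q : Type*} [DivisionRing Q] [Algebra k Q] {d : Q →ₗ[k] Q}
    (h : ∀ a b, d (a * b) = d a * b + a * d b) {q : Q} (hq : d q = 0) : d q⁻¹ = 0 := by
  by_cases h0 : q = 0
  · simp [h0]
  have h1 := h q q⁻¹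
  rw [mul_inv_cancel₀ h0, map_one_eq_zero_of_leibniz h, hq, zero_mul, zero_add, zero_eq_mul] at h1
  exact h1.resolve_left h0

end Leibniz

/-! ### Extension to fractions, traces and a central slice -/

/-- A derivation extends to the division ring of fractions. -/
theorem exists_derivation_oreLocalization {k R : Type*} [CommRing k] [Ring R] [IsDomain R]
    [Algebra k R] [OreLocalization.OreSet (nonZeroDivisors R)] {δ : R →ₗ[k] R}
    (h : ∀ a b, δ (a * b) = δ a * b + a * δ b) :
    ∃ d : OreLocalization (nonZeroDivisors R) R →ₗ[k] OreLocalization (nonZeroDivisors R) R,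
      (∀ a b, d (a * b) = d a * b + a * d b) ∧
        ∀ a, d (oreFractionHom k R a) = oreFractionHom k R (δ a) := by
  set Q := OreLocalization (nonZeroDivisors R) R
  set f := oreFractionHom k R
  have hinj : Function.Injective f :=
    OreLocalization.numeratorHom_inj fun _ h => h.1
  -- A derivation is a ring homomorphism a ↦ a + ε δ a into dual numbers, so the universal property
  -- of the localization extends it.
  let F : R →+* DualNumber Q :=
    { toFun := fun a => TrivSqZeroExt.inl (f a) + TrivSqZeroExt.inr (f (δ a))
      map_one' := by simp [map_one_eq_zero_of_leibniz h]
      map_zero' := by simp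
      map_add' := fun a b => by ext <;> simp
      map_mul' := fun a b => by ext <;> simp [h, add_comm] }
  have hunit (s : nonZeroDivisors R) : IsUnit (F s) := by
    rw [TrivSqZeroExt.isUnit_iff_isUnit_fst]
    have h1 : (F s).fst = f s := by simp [F]
    rw [h1]
    exact IsUnit.mk0 _ ((map_ne_zero_iff f hinj).2 (nonZeroDivisors.ne_zero s.2))
  let FS : nonZeroDivisors R →* (DualNumber Q)ˣ :=
    IsUnit.liftRight (F.toMonoidHom.comp (nonZeroDivisors R).subtype) hunit
  let G : Q →+* DualNumber Q := OreLocalization.universalHom F FS fun s => by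
    simp [FS, IsUnit.coe_liftRight]
  have hG (a : R) : G (f a) = F a := OreLocalization.universalHom_commutes _ _ _
  have hfst (q : Q) : (G q).fst = q := by
    induction q using OreLocalization.ind with
    | _ r s =>
      have h1 : f s * (OreLocalization.oreDiv r s) = f r := OreLocalization.mul_cancel
      have h2 := congrArg TrivSqZeroExt.fst (congrArg G h1)
      rw [map_mul, TrivSqZeroExt.fst_mul, hG, hG] at h2
      simp only [F, RingHom.coe_mk, MonoidHom.coe_mk, OneHom.coe_mk, TrivSqZeroExt.fst_add,
        TrivSqZeroExt.fst_inl, TrivSqZeroExt.fst_inr, add_zero] at h2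
      rw [← h1] at h2
      exact mul_left_cancel₀ ((map_ne_zero_iff f hinj).2 (nonZeroDivisors.ne_zero s.2)) h2
  refine ⟨{ toFun := fun q => (G q).snd, map_add' := by simp, map_smul' := fun r q => ?_ }, ?_, ?_⟩
  · have h1 : G (algebraMap k Q r) = algebraMap k (DualNumber Q) r := by
      rw [← f.commutes, hG]
      ext <;> simp [F, map_algebraMap_eq_zero_of_leibniz h] <;> rfl
    rw [Algebra.smul_def, map_mul, h1, ← Algebra.smul_def]
    simp
  · intro a b
    change (G (a * b)).snd = (G a).snd * b + a * (G b).snd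
    rw [map_mul, DualNumber.snd_mul, hfst, hfst, add_comm]
  · intro a
    change (G (f a)).snd = _
    simp [hG, F]

/-- The trace of a division ring over its center. -/
noncomputable def centerTrace (Q : Type*) [DivisionRing Q] :
    Q →ₗ[Subring.center Q] Subring.center Q :=
  (LinearMap.trace (Subring.center Q) Q) ∘ₗ (Algebra.lmul (Subring.center Q) Q).toLinearMap

theorem pow_apply_map_eq {k A Q : Type*} [CommRing k] [Ring A] [Algebra k A] [Ring Q]
    [Algebra k Q] {f : A →ₐ[k] Q} {δ : A →ₗ[k] A} {d : Q →ₗ[k] Q}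
    (hd : ∀ a, d (f a) = f (δ a)) (a : A) (n : ℕ) : (d ^ n) (f a) = f ((δ ^ n) a) := by
  induction n generalizing a with
  | zero => simp
  | succ n ih => rw [pow_succ, Module.End.mul_apply, hd, ih, pow_succ, Module.End.mul_apply]

theorem pow_apply_mul_of_apply_eq_zero {k Q : Type*} [CommRing k] [Ring Q] [Algebra k Q]
    {d : Q →ₗ[k] Q} (h : ∀ a b, d (a * b) = d a * b + a * d b) {c : Q} (hc : d c = 0) (q : Q)
    (n : ℕ) : (d ^ n) (c * q) = c * (d ^ n) q := by
  induction n generalizing q with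
  | zero => simp
  | succ n ih =>
    rw [pow_succ, Module.End.mul_apply, h, hc, zero_mul, zero_add, ih, Module.End.mul_apply]

section Slice

variable {k Q : Type*} [CommRing k] [DivisionRing Q] [Algebra k Q]
  [FiniteDimensional (Subring.center Q) Q] {d : Q →ₗ[k] Q}

/-- The trace commutes with derivations. -/
theorem apply_centerTrace_of_leibniz (h : ∀ a b, d (a * b) = d a * b + a * d b) (a : Q) :
    d (centerTrace Q a : Q) = centerTrace Q (d a) := by
  let C := Subring.center Q
  let b := Module.finBasis C Q
  let dC : C →+ C :=
    { toFun := fun z => ⟨d z, map_mem_center_of_leibniz h z.2⟩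
      map_zero' := by simp
      map_add' := fun x y => by ext; simp }
  have hdC (z : C) : (dC z : Q) = d z := rfl
  have hsmul (z : C) (q : Q) : d (z • q) = dC z • q + z • d q := by
    simp only [Subring.smul_def, smul_eq_mul, h, hdC]
  let M := LinearMap.toMatrix b b (Algebra.lmul C Q a)
  let T : Module.End C Q := b.constr C fun i => d (b i)
  have hT (i) : T (b i) = d (b i) := b.constr_basis _ _ _
  have hM (j) : a * b j = ∑ i, M i j • b i := by
    rw [← b.sum_repr (a * b j)]
    simp [M, LinearMap.toMatrix_apply]
  -- Left multiplication by d a is the commutator of d with that by a. Since d is entrywise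
  -- differentiation plus the `C`-linear `T`, this is the differentiated matrix plus a commutator,
  -- which has trace zero.
  have hL : Algebra.lmul C Q (d a) =
      Matrix.toLin b b (M.map dC) + (T * Algebra.lmul C Q a - Algebra.lmul C Q a * T) := by
    refine b.ext fun j => ?_
    have h1 := congrArg d (hM j)
    rw [h, map_sum, Finset.sum_congr rfl fun i _ => hsmul (M i j) (b i),
      Finset.sum_add_distrib] at h1
    have h2 : T (a * b j) = ∑ i, M i j • d (b i) := by
      rw [hM j, map_sum]
      simp [hT]
    simp only [LinearMap.add_apply, LinearMap.sub_apply, Module.End.mul_apply, Matrix.toLin_self,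
      Algebra.coe_lmul_eq_mul, LinearMap.mul_apply', hT, h2, Matrix.map_apply]
    rw [← add_sub_assoc, ← h1, add_sub_cancel_right]
  have h3 : centerTrace Q (d a) = dC (centerTrace Q a) := by
    change LinearMap.trace C Q (Algebra.lmul C Q (d a)) =
      dC (LinearMap.trace C Q (Algebra.lmul C Q a))
    rw [hL, map_add, map_sub, LinearMap.trace_mul_comm C T, sub_self, add_zero,
      LinearMap.trace_eq_matrix_trace C b, LinearMap.toMatrix_toLin,
      LinearMap.trace_eq_matrix_trace C b]
    simp [Matrix.trace, M, map_sum]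
  rw [h3, hdC]

theorem pow_apply_centerTrace_of_leibniz (h : ∀ a b, d (a * b) = d a * b + a * d b) (a : Q)
    (n : ℕ) : (d ^ n) (centerTrace Q a : Q) = centerTrace Q ((d ^ n) a) := by
  induction n generalizing a with
  | zero => simp
  | succ n ih =>
    rw [pow_succ, Module.End.mul_apply, Module.End.mul_apply, apply_centerTrace_of_leibniz h, ih]

/-- The trace form is nondegenerate: q = y⁻¹ would give the trace of 1, the dimension, nonzero in
characteristic zero. -/
theorem eq_zero_of_centerTrace_mul_eq_zero [CharZero Q] {y : Q}
    (hy : ∀ q, centerTrace Q (y * q) = 0) : y = 0 := by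
  by_contra h0
  have h1 := hy y⁻¹
  rw [mul_inv_cancel₀ h0] at h1
  have h2 : centerTrace Q 1 = (Module.finrank (Subring.center Q) Q : Subring.center Q) := by
    change LinearMap.trace _ Q (Algebra.lmul _ Q 1) = _
    rw [map_one, LinearMap.trace_one]
  rw [h2] at h1
  have h3 := congrArg Subtype.val h1
  simp only [Subring.coe_natCast, ZeroMemClass.coe_zero, Nat.cast_eq_zero] at h3
  exact Module.finrank_pos.ne' h3

/-- Left multiplication by a nonzero `f s` is injective on the finite-dimensional span of `A`, hence
surjective, so the span already contains all fractions. -/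
theorem IsFractionDivisionRing.span_center_eq_top {A : Type*} [Ring A] [Algebra k A]
    {f : A →ₐ[k] Q} (hf : IsFractionDivisionRing f) :
    Submodule.span (Subring.center Q) (Set.range f) = ⊤ := by
  set C := Subring.center Q
  set W := Submodule.span C (Set.range f) with hW
  rw [eq_top_iff]
  rintro q -
  obtain ⟨s, a, hs, rfl⟩ := hf.left_fraction q
  have hs' : f s ≠ 0 := (map_ne_zero_iff _ hf.injective).2 hs
  have hst : ∀ w ∈ W, LinearMap.mulLeft C (f s) w ∈ W := by
    intro w hw
    induction hw using Submodule.span_induction with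
    | mem w hw =>
      obtain ⟨b, rfl⟩ := hw
      exact Submodule.subset_span ⟨s * b, by simp⟩
    | zero => simp
    | add x y _ _ hx hy => rw [map_add]; exact add_mem hx hy
    | smul c x _ hx => rw [map_smul]; exact W.smul_mem c hx
  have hinj : Function.Injective ((LinearMap.mulLeft C (f s)).restrict hst) := by
    rintro ⟨x, hx⟩ ⟨y, hy⟩ hxy
    have := congrArg Subtype.val hxy
    exact Subtype.ext (mul_left_cancel₀ hs' this)
  obtain ⟨⟨w, hw⟩, hwa⟩ := LinearMap.surjective_of_injective hinj
    ⟨f a, Submodule.subset_span ⟨a, rfl⟩⟩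
  have h1 : f s * w = f a := congrArg Subtype.val hwa
  rwa [← h1, inv_mul_cancel_left₀ hs']

/-- A nonzero locally nilpotent derivation moves the trace of some element. -/
theorem IsFractionDivisionRing.exists_apply_centerTrace_ne_zero [CharZero Q] {A : Type*} [Ring A]
    [IsDomain A] [CharZero A] [Algebra k A] {f : A →ₐ[k] Q} (hf : IsFractionDivisionRing f)
    (h : ∀ a b, d (a * b) = d a * b + a * d b) {δ : A →ₗ[k] A} (hδ : IsLND k δ) (hδ0 : δ ≠ 0)
    (hd : ∀ a, d (f a) = f (δ a)) : ∃ a, d (centerTrace Q (f a) : Q) ≠ 0 := by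
  by_contra! hc
  let C := Subring.center Q
  let b := Module.Basis.ofSpan hf.span_center_eq_top.ge
  have hb (i) : b i ∈ Set.range f := Module.Basis.ofSpan_subset hf.span_center_eq_top.ge ⟨i, rfl⟩
  have := Module.Finite.finite_basis b
  have := Fintype.ofFinite (((linearIndepOn_empty C id).extend (Set.empty_subset (Set.range f))))
  choose e he using hb
  choose n hn using fun i => hδ.locallyNilpotent (e i)
  -- In a basis taken from `A` the coordinates will be constants of `d`, so a power of `δ` killing
  -- the finitely many basis elements kills everything.
  refine hδ0 (eq_zero_of_leibniz_of_pow_eq_zero hδ.leibniz (N := ∑ i, n i) ?_)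
  ext a
  have hsum : f a = ∑ i, (b.repr (f a) i : Q) * b i := (b.sum_repr (f a)).symm
  -- Differentiate tr(a a') = ∑ zᵢ tr(bᵢ a'): all traces are constant by assumption, so ∑ d(zᵢ) bᵢ
  -- is trace-orthogonal to `A`, hence zero.
  have hconst (i) : d (b.repr (f a) i : Q) = 0 := by
    let c' (i) : C := ⟨d (b.repr (f a) i : Q), map_mem_center_of_leibniz h (b.repr (f a) i).2⟩
    have htr (y : Q) (z : _ → C) (hz : y = ∑ i, z i • b i) (q : Q) :
        centerTrace Q (y * q) = ∑ i, z i * centerTrace Q (b i * q) := by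
      rw [hz, Finset.sum_mul, map_sum]
      simp
    have hy : ∑ i, c' i • b i = 0 := by
      refine eq_zero_of_centerTrace_mul_eq_zero fun q => ?_
      have hq : q ∈ Submodule.span C (Set.range f) := by
        rw [hf.span_center_eq_top]
        trivial
      refine (Submodule.span_le (p := LinearMap.ker
        (centerTrace Q ∘ₗ LinearMap.mulLeft C (∑ i, c' i • b i)))).2 ?_ hq
      rintro _ ⟨a', rfl⟩
      have h1 := congrArg d (congrArg Subtype.val (htr (f a) _ hsum (f a')))
      rw [← map_mul, hc, AddSubmonoidClass.coe_finsetSum, map_sum] at h1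
      have h2 (i) : d ((b.repr (f a) i * centerTrace Q (b i * f a') : C) : Q) =
          (c' i * centerTrace Q (b i * f a') : C) := by
        rw [Subring.coe_mul, h, ← he, ← map_mul, hc, mul_zero, add_zero]
        rfl
      simp only [h2] at h1
      change centerTrace Q ((∑ i, c' i • b i) * f a') = 0
      rw [htr _ c' rfl]
      ext
      rw [AddSubmonoidClass.coe_finsetSum]
      exact h1.symm
    exact congrArg Subtype.val (Fintype.linearIndependent_iff.1 b.linearIndependent c' hy i)
  apply hf.injective
  rw [← pow_apply_map_eq hd, hsum, map_sum, LinearMap.zero_apply, map_zero]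
  refine Finset.sum_eq_zero fun i _ => ?_
  rw [pow_apply_mul_of_apply_eq_zero h (hconst i), ← he, pow_apply_map_eq hd,
    pow_apply_eq_zero_of_le (hn i) (Finset.single_le_sum (fun _ _ => Nat.zero_le _)
      (Finset.mem_univ i)), map_zero, mul_zero]

theorem IsFractionDivisionRing.exists_central_slice [CharZero Q] {A : Type*} [Ring A]
    [IsDomain A] [CharZero A] [Algebra k A] {f : A →ₐ[k] Q} (hf : IsFractionDivisionRing f)
    (h : ∀ a b, d (a * b) = d a * b + a * d b) {δ : A →ₗ[k] A} (hδ : IsLND k δ) (hδ0 : δ ≠ 0)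
    (hd : ∀ a, d (f a) = f (δ a)) : ∃ x ∈ Subring.center Q, d x = 1 := by
  obtain ⟨a, ha⟩ := hf.exists_apply_centerTrace_ne_zero h hδ hδ0 hd
  obtain ⟨n, hn⟩ := hδ.locallyNilpotent (δ a)
  have hz (m : ℕ) : (d ^ m) (centerTrace Q (f a) : Q) = centerTrace Q (f ((δ ^ m) a)) := by
    rw [pow_apply_centerTrace_of_leibniz h, pow_apply_map_eq hd]
  obtain ⟨m, hm, hm'⟩ := exists_pow_apply_ne_zero (δ := d) ha ⟨n, by
    rw [← Module.End.mul_apply, ← pow_succ, hz, pow_succ, Module.End.mul_apply, hn]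
    simp⟩
  set y := (d ^ m) (centerTrace Q (f a) : Q) with hy
  have hyc : y ∈ Subring.center Q := by
    rw [hy, hz]
    exact Subtype.property _
  have hdy : d y = (d ^ m) (d (centerTrace Q (f a) : Q)) := by
    rw [hy, ← Module.End.mul_apply, ← Module.End.mul_apply, ← pow_succ, ← pow_succ']
  have hy0 : d y ≠ 0 := hdy ▸ hm
  have hddy : d (d y) = 0 := by
    rw [hdy, ← Module.End.mul_apply, ← pow_succ', hm']
  refine ⟨y * (d y)⁻¹, mul_mem hyc (Set.inv_mem_center (map_mem_center_of_leibniz h hyc)), ?_⟩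
  rw [h, map_inv_of_leibniz h hddy, mul_zero, add_zero, mul_inv_cancel₀ hy0]

end Slice

/-! ### The division ring of fractions as D(x) -/

section Constants

variable {k Q : Type*} [CommRing k] [DivisionRing Q] [Algebra k Q] {d : Q →ₗ[k] Q}

/-- The constants of a derivation. -/
def constantSubalgebra (d : Q →ₗ[k] Q) (h : ∀ a b, d (a * b) = d a * b + a * d b) :
    Subalgebra k Q where
  carrier := {q | d q = 0}
  mul_mem' {a b} (ha : d a = 0) (hb : d b = 0) := by
    change d (a * b) = 0
    rw [h, ha, hb, zero_mul, mul_zero, add_zero]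
  add_mem' {a b} (ha : d a = 0) (hb : d b = 0) := by
    change d (a + b) = 0
    rw [map_add, ha, hb, add_zero]
  algebraMap_mem' := map_algebraMap_eq_zero_of_leibniz h

@[reducible]
noncomputable def constantDivisionRing (d : Q →ₗ[k] Q)
    (h : ∀ a b, d (a * b) = d a * b + a * d b) : DivisionRing (constantSubalgebra d h) :=
  { (inferInstance : Ring (constantSubalgebra d h)) with
    inv := fun x => ⟨(x : Q)⁻¹, map_inv_of_leibniz h x.2⟩
    exists_pair_ne := exists_pair_ne _
    mul_inv_cancel := fun _ hx => Subtype.ext (mul_inv_cancel₀ fun h0 => hx (Subtype.ext h0))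
    inv_zero := Subtype.ext inv_zero
    nnqsmul := _
    qsmul := _ }

/-- Evaluation of polynomials over the constants at a central element. -/
noncomputable def constantEval (h : ∀ a b, d (a * b) = d a * b + a * d b) {x : Q}
    (hx : x ∈ Subring.center Q) : Polynomial (constantSubalgebra d h) →ₐ[k] Q :=
  { Polynomial.eval₂RingHom' (constantSubalgebra d h).val.toRingHom x
      fun a => Subring.mem_center_iff.1 hx a with
    commutes' := fun _ => Polynomial.eval₂_C _ _ }

theorem constantEval_monomial (h : ∀ a b, d (a * b) = d a * b + a * d b) {x : Q}
    (hx : x ∈ Subring.center Q) (n : ℕ) (a : constantSubalgebra d h) :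
    constantEval h hx (Polynomial.monomial n a) = a * x ^ n := by
  exact Polynomial.eval₂_monomial (constantSubalgebra d h).val.toRingHom x

theorem apply_pow_of_slice (h : ∀ a b, d (a * b) = d a * b + a * d b) {x : Q} (hdx : d x = 1)
    (n : ℕ) : d (x ^ n) = n * x ^ (n - 1) := by
  induction n with
  | zero => simpa using map_one_eq_zero_of_leibniz h
  | succ n ih =>
    rw [pow_succ, h, ih, hdx, mul_one, mul_assoc]
    rcases n with _ | n
    · simp
    · simp [pow_succ, add_mul]

theorem apply_constantEval (h : ∀ a b, d (a * b) = d a * b + a * d b) {x : Q}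
    (hx : x ∈ Subring.center Q) (hdx : d x = 1) (p : Polynomial (constantSubalgebra d h)) :
    d (constantEval h hx p) = constantEval h hx (Polynomial.derivative p) := by
  induction p using Polynomial.induction_on' with
  | add p q hp hq => rw [map_add, map_add, hp, hq, Polynomial.derivative_add, map_add]
  | monomial n a =>
    have ha : d (a : Q) = 0 := a.2
    rw [Polynomial.derivative_monomial, constantEval_monomial, constantEval_monomial, h, ha,
      zero_mul, zero_add, apply_pow_of_slice h hdx]
    simp [mul_assoc]

theorem constantEval_injective [CharZero Q] (h : ∀ a b, d (a * b) = d a * b + a * d b) {x : Q}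
    (hx : x ∈ Subring.center Q) (hdx : d x = 1) : Function.Injective (constantEval h hx) := by
  rw [injective_iff_map_eq_zero]
  intro p hp
  induction hn : p.natDegree using Nat.strong_induction_on generalizing p with
  | _ n ih =>
    have h0 : p.natDegree = 0 := by
      by_contra hne
      have h1 := ih _ (hn ▸ Polynomial.natDegree_derivative_lt hne) (Polynomial.derivative p)
        (by rw [← apply_constantEval h hx hdx, hp, map_zero]) rfl
      exact hne (Polynomial.derivative_eq_zero.1 h1)
    rw [Polynomial.eq_C_of_natDegree_eq_zero h0, ← Polynomial.monomial_zero_left,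
      constantEval_monomial, pow_zero, mul_one] at hp
    rw [Polynomial.eq_C_of_natDegree_eq_zero h0,
      show p.coeff 0 = 0 from Subtype.ext hp, Polynomial.C_0]

/-- Integration: an antiderivative of the polynomial for `d q` differs from `q` by a constant. -/
theorem exists_constantEval_eq [CharZero Q] (h : ∀ a b, d (a * b) = d a * b + a * d b) {x : Q}
    (hx : x ∈ Subring.center Q) (hdx : d x = 1) (n : ℕ) (q : Q) (hq : (d ^ n) q = 0) :
    ∃ p, constantEval h hx p = q := by
  induction n generalizing q with
  | zero => exact ⟨0, by simpa using hq.symm⟩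
  | succ n ih =>
    obtain ⟨p, hp⟩ := ih (d q) (by rwa [← Module.End.mul_apply, ← pow_succ])
    obtain ⟨P, rfl⟩ : ∃ P, Polynomial.derivative P = p := by
      clear hp
      induction p using Polynomial.induction_on' with
      | add p q hp hq =>
        obtain ⟨P, rfl⟩ := hp
        obtain ⟨R, rfl⟩ := hq
        exact ⟨P + R, Polynomial.derivative_add⟩
      | monomial n a =>
        let _ := constantDivisionRing d h
        refine ⟨Polynomial.monomial (n + 1) (a * ((n + 1 : ℕ) : constantSubalgebra d h)⁻¹), ?_⟩
        rw [Polynomial.derivative_monomial, Nat.add_sub_cancel, inv_mul_cancel_right₀]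
        exact Nat.cast_ne_zero.2 n.succ_ne_zero
    have h1 : d (q - constantEval h hx P) = 0 := by
      rw [map_sub, apply_constantEval h hx hdx, hp, sub_self]
    refine ⟨P + Polynomial.C ⟨_, h1⟩, ?_⟩
    rw [map_add, ← Polynomial.monomial_zero_left, constantEval_monomial]
    simp

end Constants

/-- A domain whose fraction division ring has a derivation with a central slice, locally nilpotent
on the domain, is birationally affine-ruled. -/
theorem IsFractionDivisionRing.isBirationallyAffineRuled {k : Type*} {A Q : Type v} [CommRing k]
    [Ring A] [Algebra k A] [DivisionRing Q] [CharZero Q] [Algebra k Q] {f : A →ₐ[k] Q}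
    (hf : IsFractionDivisionRing f) {d : Q →ₗ[k] Q} (h : ∀ a b, d (a * b) = d a * b + a * d b)
    {x : Q} (hx : x ∈ Subring.center Q) (hdx : d x = 1) (hd : ∀ a, ∃ n, (d ^ n) (f a) = 0) :
    IsBirationallyAffineRuled k A := by
  have hex (a : A) : ∃ p, constantEval h hx p = f a :=
    let ⟨n, hn⟩ := hd a
    exists_constantEval_eq h hx hdx n _ hn
  have hinj := constantEval_injective h hx hdx
  have hne {s : A} (hs : s ≠ 0) {p} (hp : constantEval h hx p = f s) : p ≠ 0 := by
    rintro rfl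
    rw [map_zero] at hp
    exact (map_ne_zero_iff _ hf.injective).2 hs hp.symm
  refine ⟨Q, inferInstance, inferInstance, constantSubalgebra d h, constantDivisionRing d h,
    inferInstance, f, constantEval h hx, hf, hinj, fun q => ?_, fun q => ?_⟩
  · obtain ⟨s, a, hs, rfl⟩ := hf.left_fraction q
    obtain ⟨p, hp⟩ := hex s
    obtain ⟨r, hr⟩ := hex a
    exact ⟨p, r, hne hs hp, by rw [hp, hr]⟩
  · obtain ⟨a, s, hs, rfl⟩ := hf.right_fraction q
    obtain ⟨p, hp⟩ := hex s
    obtain ⟨r, hr⟩ := hex a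
    exact ⟨r, p, hne hs hp, by rw [hp, hr]⟩

theorem IsPI.isBirationallyAffineRuled {k : Type*} {A : Type v} [CommRing k] [Ring A] [IsDomain A]
    [CharZero A] [Algebra k A] (hPI : IsPI k A) {δ : A →ₗ[k] A} (hδ : IsLND k δ) (hδ0 : δ ≠ 0) :
    IsBirationallyAffineRuled k A := by
  obtain ⟨n, c, hc1, hc⟩ := hPI.exists_multilinear
  obtain ⟨_⟩ := hc.nonempty_oreSet hc1
  have hf := isFractionDivisionRing_oreFractionHom (k := k) (R := A)
    fun a b hb => hc.exists_mul_eq_mul' hc1 hb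
  set Q := OreLocalization (nonZeroDivisors A) A
  have hQ : CharZero Q :=
    charZero_of_injective_ringHom (f := (oreFractionHom k A).toRingHom) hf.injective
  obtain ⟨d, h, hd⟩ := exists_derivation_oreLocalization hδ.leibniz
  have hcQ : IsMultilinearIdentity Q fun σ =>
      (⟨algebraMap k Q (c σ), Subring.mem_center_iff.2 fun q => (Algebra.commutes _ q).symm⟩ :
        Subring.center Q) := by
    intro z
    simpa [Subring.smul_def, ← Algebra.smul_def] using hc.fractions hf z
  have : Algebra.IsCentral (Subring.center Q) Q := ⟨fun q hq => Algebra.mem_bot.2 ⟨⟨q, hq⟩, rfl⟩⟩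
  have : FiniteDimensional (Subring.center Q) Q := hcQ.finiteDimensional fun h0 => by
    have h1 : algebraMap k Q (c 1) = 0 := congrArg Subtype.val h0
    rw [← (oreFractionHom k A).commutes, map_eq_zero_iff _ hf.injective] at h1
    exact hc1 h1
  obtain ⟨x, hx, hdx⟩ := hf.exists_central_slice h hδ hδ0 hd
  refine hf.isBirationallyAffineRuled h hx hdx fun a => ?_
  obtain ⟨m, hm⟩ := hδ.locallyNilpotent a
  exact ⟨m, by rw [pow_apply_map_eq hd, hm, map_zero]⟩

theorem isLNDRigid_iff {k A : Type*} [CommRing k] [Ring A] [Algebra k A] :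
    IsLNDRigid k A ↔ ∀ δ : A →ₗ[k] A, IsLND k δ → δ = 0 := by
  simp only [IsLNDRigid, makarLimanov, iInf_eq_top, LinearMap.ker_eq_top]

open Polynomial

/-! ### Locally nilpotent derivations of A[X] -/

section TopComponent

variable {k A : Type*} [CommRing k] [Ring A] [Algebra k A] {d : A[X] →ₗ[k] A[X]}

theorem commute_apply_X_of_leibniz (h : ∀ a b, d (a * b) = d a * b + a * d b) (p : A[X]) :
    Commute (d X) p := by
  have hX : (X : A[X]) ∈ Subring.center A[X] :=
    Subring.mem_center_iff.2 fun p => (commute_X p).symm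
  exact (Subring.mem_center_iff.1 (map_mem_center_of_leibniz h hX) p).symm

/-- The subalgebra of coefficients whose derivative has degree at most `N`. -/
def natDegreeLESubalgebra (h : ∀ a b, d (a * b) = d a * b + a * d b) (N : ℕ) : Subalgebra k A where
  carrier := {a | (d (C a)).natDegree ≤ N}
  mul_mem' {a b} (ha : (d (C a)).natDegree ≤ N) (hb : (d (C b)).natDegree ≤ N) := by
    change (d (C (a * b))).natDegree ≤ N
    rw [C_mul, h]
    refine (natDegree_add_le _ _).trans (max_le ?_ ?_)
    · exact (natDegree_mul_C_le _ _).trans ha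
    · exact (natDegree_C_mul_le _ _).trans hb
  add_mem' {a b} (ha : (d (C a)).natDegree ≤ N) (hb : (d (C b)).natDegree ≤ N) := by
    change (d (C (a + b))).natDegree ≤ N
    rw [C_add, map_add]
    exact (natDegree_add_le _ _).trans (max_le ha hb)
  algebraMap_mem' r := by
    change (d (algebraMap k A[X] r)).natDegree ≤ N
    rw [map_algebraMap_eq_zero_of_leibniz h]
    simp

/-- A bound on finitely many generators holds everywhere, because the elements obeying it form a
subalgebra. -/
theorem exists_natDegree_apply_C_le [hfg : Algebra.FiniteType k A]
    (h : ∀ a b, d (a * b) = d a * b + a * d b) : ∃ N, ∀ a, (d (C a)).natDegree ≤ N := by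
  obtain ⟨S, hS⟩ := hfg.out
  refine ⟨S.sup fun a => (d (C a)).natDegree, fun a => ?_⟩
  have h1 : Algebra.adjoin k (S : Set A) ≤
      natDegreeLESubalgebra h (S.sup fun a => (d (C a)).natDegree) :=
    Algebra.adjoin_le fun s hs => Finset.le_sup (f := fun a => (d (C a)).natDegree) hs
  rw [hS] at h1
  exact h1 (Algebra.mem_top (x := a))

/-- The coefficient map of the homogeneous component of degree `N` of `d` on monomials of
degree `i`. -/
noncomputable def topCoeff (d : A[X] →ₗ[k] A[X]) (N i : ℕ) : A →ₗ[k] A where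
  toFun a := (d (C a)).coeff N + i • (a * (d X).coeff (N + 1))
  map_add' a b := by simp only [map_add, coeff_add, add_mul, smul_add]; abel
  map_smul' r a := by
    simp only [← smul_C, map_smul, coeff_smul, smul_mul_assoc, RingHom.id_apply, smul_add]
    rw [smul_comm]

theorem topCoeff_apply (N i : ℕ) (a : A) :
    topCoeff d N i a = (d (C a)).coeff N + i • (a * (d X).coeff (N + 1)) := rfl

/-- The homogeneous component of degree `N` of `d`. -/
noncomputable def topComponent (d : A[X] →ₗ[k] A[X]) (N : ℕ) : A[X] →ₗ[k] A[X] :=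
  Polynomial.lsum fun i => ((monomial (i + N)).restrictScalars k : A →ₗ[k] A[X]) ∘ₗ topCoeff d N i

theorem topComponent_monomial (N i : ℕ) (a : A) :
    topComponent d N (monomial i a) = monomial (i + N) (topCoeff d N i a) := by
  simp [topComponent, lsum_apply, sum_monomial_index]

theorem topCoeff_mul (h : ∀ a b, d (a * b) = d a * b + a * d b) (N i j : ℕ) (a b : A) :
    topCoeff d N (i + j) (a * b) = topCoeff d N i a * b + a * topCoeff d N j b := by
  have hcomm : b * (d X).coeff (N + 1) = (d X).coeff (N + 1) * b := by
    rw [← coeff_C_mul, ← coeff_mul_C, (commute_apply_X_of_leibniz h (C b)).eq]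
  simp only [topCoeff_apply, C_mul, h, coeff_add, coeff_mul_C, coeff_C_mul, add_smul, mul_add,
    add_mul, mul_smul_comm, smul_mul_assoc, mul_assoc, hcomm]
  abel

theorem topComponent_leibniz (h : ∀ a b, d (a * b) = d a * b + a * d b) (N : ℕ) (p q : A[X]) :
    topComponent d N (p * q) = topComponent d N p * q + p * topComponent d N q := by
  induction p using Polynomial.induction_on' with
  | add p p' hp hp' => simp only [add_mul, map_add, hp, hp']; abel
  | monomial i a =>
    induction q using Polynomial.induction_on' with
    | add q q' hq hq' => simp only [mul_add, map_add, hq, hq']; abel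
    | monomial j b =>
      rw [monomial_mul_monomial, topComponent_monomial, topCoeff_mul h, topComponent_monomial,
        topComponent_monomial, monomial_mul_monomial, monomial_mul_monomial, map_add]
      congr 2 <;> congr 1 <;> omega

theorem apply_X_pow_of_leibniz (h : ∀ a b, d (a * b) = d a * b + a * d b) (i : ℕ) :
    d (X ^ (i + 1)) = (i + 1) • (d X * X ^ i) := by
  induction i with
  | zero => simp
  | succ i ih =>
    rw [pow_succ X (i + 1), h, ih, smul_mul_assoc, mul_assoc, ← pow_succ,
      (commute_apply_X_of_leibniz h (X ^ (i + 1))).eq.symm, succ_nsmul _ (i + 1)]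

variable {N : ℕ}

theorem coeff_apply_monomial (h : ∀ a b, d (a * b) = d a * b + a * d b)
    (hN : ∀ a, (d (C a)).natDegree ≤ N) (hX : (d X).natDegree ≤ N + 1) (i : ℕ) (a : A) {m : ℕ}
    (hm : i + N ≤ m) :
    (d (monomial i a)).coeff m = if m = i + N then topCoeff d N i a else 0 := by
  have h1 : (d (C a) * X ^ i).coeff m = if m = i + N then (d (C a)).coeff N else 0 := by
    obtain ⟨m, rfl⟩ := Nat.exists_eq_add_of_le (show i ≤ m by omega)
    rw [add_comm i m, coeff_mul_X_pow]
    split_ifs with hmi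
    · congr 1
      omega
    · exact coeff_eq_zero_of_natDegree_lt ((hN a).trans_lt (by omega))
  rw [← C_mul_X_pow_eq_monomial, h, coeff_add, h1, coeff_C_mul, topCoeff_apply]
  rcases i with _ | i
  · simp [map_one_eq_zero_of_leibniz h]
  have h2 : (d X * X ^ i).coeff m = if m = i + 1 + N then (d X).coeff (N + 1) else 0 := by
    obtain ⟨m, rfl⟩ := Nat.exists_eq_add_of_le (show i ≤ m by omega)
    rw [add_comm i m, coeff_mul_X_pow]
    split_ifs with hmi
    · congr 1
      omega
    · exact coeff_eq_zero_of_natDegree_lt (hX.trans_lt (by omega))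
  rw [apply_X_pow_of_leibniz h, coeff_smul, h2, mul_smul_comm]
  split_ifs <;> simp

theorem coeff_apply_of_natDegree_le (h : ∀ a b, d (a * b) = d a * b + a * d b)
    (hN : ∀ a, (d (C a)).natDegree ≤ N) (hX : (d X).natDegree ≤ N + 1) {i : ℕ} {p : A[X]}
    (hp : p.natDegree ≤ i) {m : ℕ} (hm : i + N ≤ m) :
    (d p).coeff m = if m = i + N then topCoeff d N i (p.coeff i) else 0 := by
  rw [p.as_sum_range' (i + 1) (by omega), map_sum, finsetSum_coeff, Finset.sum_range_succ,
    coeff_apply_monomial h hN hX i _ hm, Finset.sum_eq_zero, zero_add,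
    ← p.as_sum_range' (i + 1) (by omega)]
  intro j hj
  rw [Finset.mem_range] at hj
  rw [coeff_apply_monomial h hN hX j _ (by omega), if_neg (by omega)]

theorem natDegree_apply_le (h : ∀ a b, d (a * b) = d a * b + a * d b)
    (hN : ∀ a, (d (C a)).natDegree ≤ N) (hX : (d X).natDegree ≤ N + 1) {i : ℕ} {p : A[X]}
    (hp : p.natDegree ≤ i) : (d p).natDegree ≤ i + N := by
  rw [natDegree_le_iff_coeff_eq_zero]
  intro m hm
  rw [coeff_apply_of_natDegree_le h hN hX hp hm.le, if_neg hm.ne']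

/-- Powers of the top component read off top coefficients of powers of `d`, so it inherits local
nilpotency. -/
theorem topComponent_pow_monomial (h : ∀ a b, d (a * b) = d a * b + a * d b)
    (hN : ∀ a, (d (C a)).natDegree ≤ N) (hX : (d X).natDegree ≤ N + 1) (n : ℕ) {i : ℕ} {p : A[X]}
    (hp : p.natDegree ≤ i) :
    (topComponent d N ^ n) (monomial i (p.coeff i)) =
      monomial (i + n * N) (((d ^ n) p).coeff (i + n * N)) := by
  induction n generalizing i p with
  | zero => simp
  | succ n ih =>
    have h1 := coeff_apply_of_natDegree_le h hN hX hp le_rfl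
    rw [if_pos rfl] at h1
    rw [pow_succ, Module.End.mul_apply, topComponent_monomial, ← h1,
      ih (natDegree_apply_le h hN hX hp), pow_succ, Module.End.mul_apply,
      show i + N + n * N = i + (n + 1) * N by ring]

theorem IsLND.isLND_topComponent (hd : IsLND k d) (hN : ∀ a, (d (C a)).natDegree ≤ N)
    (hX : (d X).natDegree ≤ N + 1) : IsLND k (topComponent d N) := by
  refine ⟨topComponent_leibniz hd.leibniz N, fun p => ?_⟩
  induction p using Polynomial.induction_on' with
  | add p q hp hq =>
    obtain ⟨n, hn⟩ := hp
    obtain ⟨m, hm⟩ := hq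
    exact ⟨n + m, by rw [map_add, pow_apply_eq_zero_of_le hn (by omega),
      pow_apply_eq_zero_of_le hm (by omega), add_zero]⟩
  | monomial i a =>
    obtain ⟨n, hn⟩ := hd.locallyNilpotent (monomial i a)
    have h1 := topComponent_pow_monomial hd.leibniz hN hX n (natDegree_monomial_le a (m := i))
    rw [coeff_monomial_same] at h1
    exact ⟨n, by rw [h1, hn]; simp⟩

/-- If `A` has no nonzero locally nilpotent derivations, then those of `A[X]` kill `A`. -/
theorem IsLND.apply_C_eq_zero [IsDomain A] [CharZero A] [Algebra.FiniteType k A]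
    (hA : ∀ δ : A →ₗ[k] A, IsLND k δ → δ = 0) (hd : IsLND k d) (a : A) : d (C a) = 0 := by
  classical
  by_contra ha
  -- `N` bounds how far `d` raises the degree; `X` already has degree 1, hence N + 1. The least such
  -- `N` will be lowered.
  have hex : ∃ N, (∀ a, (d (C a)).natDegree ≤ N) ∧ (d X).natDegree ≤ N + 1 := by
    obtain ⟨N, hN⟩ := exists_natDegree_apply_C_le hd.leibniz
    exact ⟨max N (d X).natDegree, fun a => (hN a).trans (le_max_left _ _), by omega⟩
  obtain ⟨hN, hX⟩ := Nat.find_spec hex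
  set N := Nat.find hex
  have htop := hd.isLND_topComponent hN hX
  -- The top component sends X to a multiple of X, so it must kill X. Its action on coefficients is
  -- then independent of the degree and gives a derivation of `A`.
  have hX0 : (d X).coeff (N + 1) = 0 := by
    have h1 : topComponent d N X = monomial (1 + N) ((d X).coeff (N + 1)) := by
      rw [← monomial_one_one_eq_X, topComponent_monomial, topCoeff_apply, C_1,
        map_one_eq_zero_of_leibniz hd.leibniz, monomial_one_one_eq_X]
      simp
    have h2 := htop.apply_eq_zero_of_eq_mul (u := X) (g := monomial N ((d X).coeff (N + 1)))
      (by rw [h1, X_mul_monomial, add_comm])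
    rwa [h1, monomial_eq_zero_iff] at h2
  have hcoeff (i : ℕ) : topCoeff d N i = topCoeff d N 0 := by
    ext b
    simp [topCoeff_apply, hX0]
  have hpow (n i : ℕ) (b : A) : (topComponent d N ^ n) (monomial i b) =
      monomial (i + n * N) ((topCoeff d N 0 ^ n) b) := by
    induction n generalizing i b with
    | zero => simp
    | succ n ih =>
      rw [pow_succ, Module.End.mul_apply, topComponent_monomial, hcoeff, ih, pow_succ,
        Module.End.mul_apply, show i + N + n * N = i + (n + 1) * N by ring]
  have hδ : IsLND k (topCoeff d N 0) := by
    refine ⟨fun a b => by simpa using topCoeff_mul hd.leibniz N 0 0 a b, fun b => ?_⟩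
    obtain ⟨n, hn⟩ := htop.locallyNilpotent (monomial 0 b)
    rw [hpow, monomial_eq_zero_iff] at hn
    exact ⟨n, hn⟩
  have hC0 (b : A) : (d (C b)).coeff N = 0 := by
    simpa [topCoeff_apply] using LinearMap.congr_fun (hA _ hδ) b
  have hlt {p : A[X]} {m : ℕ} (hp : p.natDegree ≤ m + 1) (h0 : p.coeff (m + 1) = 0) :
      p.natDegree ≤ m := by
    rw [natDegree_le_iff_coeff_eq_zero]
    intro j hj
    rcases (show m + 1 ≤ j from hj).eq_or_lt with rfl | hj
    · exact h0
    · exact coeff_eq_zero_of_natDegree_lt (hp.trans_lt hj)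
  rcases hN0 : N with _ | M
  · rw [hN0] at hN hC0
    apply ha
    rw [eq_C_of_natDegree_le_zero (hN a), hC0, C_0]
  · rw [hN0] at hN hC0 hX hX0
    exact Nat.find_min hex (m := M) (by omega)
      ⟨fun b => hlt (hN b) (hC0 b), hlt hX hX0⟩

end TopComponent

/-! ### Cancellation -/

theorem isLND_derivative (k B : Type*) [CommRing k] [Ring B] [Algebra k B] :
    IsLND k (derivative.restrictScalars k : B[X] →ₗ[k] B[X]) := by
  refine ⟨fun p q => derivative_mul, fun p => ⟨p.natDegree + 1, ?_⟩⟩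
  have h (n : ℕ) : ((derivative.restrictScalars k : B[X] →ₗ[k] B[X]) ^ n) p = derivative^[n] p := by
    rw [Module.End.pow_apply]
    rfl
  rw [h]
  exact iterate_derivative_eq_zero (Nat.lt_succ_self _)

theorem IsLND.conj {k R S : Type*} [CommRing k] [Ring R] [Algebra k R] [Ring S] [Algebra k S]
    (φ : R ≃ₐ[k] S) {d : S →ₗ[k] S} (hd : IsLND k d) :
    IsLND k (φ.symm.toLinearMap ∘ₗ d ∘ₗ φ.toLinearMap) := by
  refine ⟨fun a b => by simp [hd.leibniz], fun a => ?_⟩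
  obtain ⟨n, hn⟩ := hd.locallyNilpotent (φ a)
  refine ⟨n, φ.injective ?_⟩
  have h := pow_apply_map_eq (f := φ.toAlgHom) (d := d)
    (δ := φ.symm.toLinearMap ∘ₗ d ∘ₗ φ.toLinearMap) (by simp) a n
  rw [map_zero, ← hn]
  exact h.symm

theorem isCancellative_of_forall_isLND_eq_zero {k : Type*} {A : Type v} [CommRing k] [Ring A]
    [IsDomain A] [CharZero A] [Algebra k A] [Algebra.FiniteType k A]
    (hA : ∀ δ : A →ₗ[k] A, IsLND k δ → δ = 0) : IsCancellative k A := by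
  rintro B _ _ ⟨φ⟩
  have : IsDomain B[X] := φ.symm.injective.isDomain φ.symm
  have : IsDomain B := (C_injective (R := B)).isDomain C
  have : CharZero B := by
    have : CharZero B[X] := charZero_of_injective_ringHom (f := φ.toRingEquiv.toRingHom) φ.injective
    exact ⟨fun m n hmn => Nat.cast_injective (R := B[X]) (by
      rw [← C_eq_natCast, ← C_eq_natCast, hmn])⟩
  -- The derivation d/dX of B[X], pulled back along `φ`, kills `A`; in characteristic zero `φ`
  -- therefore sends constants to constants.
  have hC (a : A) : φ (C a) = C ((φ (C a)).coeff 0) := by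
    have h1 := ((isLND_derivative k B).conj φ).apply_C_eq_zero hA a
    have h2 : derivative (φ (C a)) = 0 := by simpa using h1
    exact eq_C_of_natDegree_eq_zero (derivative_eq_zero.1 h2)
  let ψ : A →ₐ[k] B :=
    { constantCoeff.comp (φ.toRingEquiv.toRingHom.comp C) with
      commutes' := fun r => by
        change (φ (algebraMap k A[X] r)).coeff 0 = _
        rw [φ.commutes]
        exact coeff_C_zero }
  have hψ (a : A) : φ (C a) = C (ψ a) := hC a
  have hinj : Function.Injective ψ := fun a b hab =>
    C_injective (φ.injective (by rw [hψ, hψ, hab]))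
  have hcomp (p : A[X]) : φ p = (p.map ψ.toRingHom).comp (φ X) := by
    induction p using Polynomial.induction_on' with
    | add p q hp hq => rw [map_add, hp, hq, Polynomial.map_add, add_comp]
    | monomial n a =>
      rw [← C_mul_X_pow_eq_monomial, map_mul, map_pow, hψ, C_mul_X_pow_eq_monomial, map_monomial,
        monomial_comp]
      rfl
  -- Since `φ` is substitution of `φ X`, degrees multiply. As X lies in the image, `φ X` is not
  -- constant, so preimages of constants are constant and `ψ` is onto.
  have hdeg (p : A[X]) : (φ p).natDegree = p.natDegree * (φ X).natDegree := by
    rw [hcomp p, natDegree_comp, natDegree_map_eq_of_injective hinj]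
  have hX : (φ X).natDegree ≠ 0 := by
    intro h0
    have h1 := hdeg (φ.symm X)
    rw [h0, mul_zero, φ.apply_symm_apply, natDegree_X] at h1
    exact one_ne_zero h1
  refine ⟨AlgEquiv.ofBijective ψ ⟨hinj, fun b => ?_⟩⟩
  have h1 := hdeg (φ.symm (C b))
  rw [φ.apply_symm_apply, natDegree_C, zero_eq_mul] at h1
  have h2 := eq_C_of_natDegree_eq_zero (h1.resolve_right hX)
  refine ⟨(φ.symm (C b)).coeff 0, C_injective ?_⟩
  rw [← hψ, ← h2, φ.apply_symm_apply]

theorem corollary3p9 {k : Type*} {A : Type*} [CommRing k] [IsDomain k]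
    [Ring A] [IsDomain A] [CharZero A] [Algebra k A]
    (hfg : Algebra.FiniteType k A)
    (hPI : IsPI k A)
    (hGK : gkDim k A < ⊤)
    (hA : ¬ IsBirationallyAffineRuled k A) :
    IsLNDRigid k A ∧ IsCancellative k A := by
  have h : ∀ δ : A →ₗ[k] A, IsLND k δ → δ = 0 := fun δ hδ =>
    by_contra fun h0 => hA (hPI.isBirationallyAffineRuled hδ h0)
  exact ⟨isLNDRigid_iff.2 h, isCancellative_of_forall_isLND_eq_zero h⟩
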